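/- **Setting.** Let $p$ be a prime and let $R$ be a $p$-adically complete (and separated) integral domain of characteristic zero. Let $f\in R[x_1^{\pm1},\dots,x_n^{\pm1}]$ have Newton polytope $\Delta\subset\mathbb R^n$, and let $\mathbf b$ be a vertex of $\Delta$ such that the coefficient of $\mathbf x^{\mathbf b}$ in $f$ is a unit of $R$. A set $\mu\subseteq\Delta$ is *open* if $\Delta\setminus\mu$ is a union of faces of $\Delta$; fix such a $\mu$, and put $\mu_{\mathbb Z}=\mu\cap\mathbb Z^n$, $h=\#\mu_{\mathbb Z}$. A *Frobenius lift* is a ring endomorphism $\sigma$ of $R$ with $\sigma(r)\equiv r^p \bmod p$ for all $r\in R$; $f^\sigma$ denotes $f$ with $\sigma$ applied to its coefficients. Let $\Omega_f(\mu)$ be the $R$-module of the rational functions $(k-1)!\,g/f^k$ with $k\ge1$, $g\in R[x_1^{\pm1},\dots,x_n^{\pm1}]$, $\mathrm{supp}(g)\subset k\mu$, and $\widehat\Omega_f(\mu)$ its $p$-adic completion. All rational functions are expanded into formal Laurent series at the vertex $\mathbf b$ (this embeds $\widehat\Omega_f(\mu)$, and likewise $\widehat\Omega_{f^{\sigma^s}}(\mu)$,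 into formal Laurent series). On formal series put $\mathscr C_p(\sum a_{\mathbf k}\mathbf x^{\mathbf k})=\sum a_{p\mathbf k}\mathbf x^{\mathbf k}$, let derivations of $R$ act coefficientwise, and let $$U_f(\mu)=\{\omega\in\widehat\Omega_f(\mu) : \mathscr C_p^s(\omega)\in p^s\,\widehat\Omega_{f^{\sigma^s}}(\mu)\ \text{for all } s\ge1\}.$$ For $\mathbf u\in\mu_{\mathbb Z}$ let $\omega_{\mathbf u}=\mathbf x^{\mathbf u}/f$ and $\omega^\sigma_{\mathbf u}=\mathbf x^{\mathbf u}/f^\sigma$. Let $\beta_p(\mu)=(\text{coefficient of }\mathbf x^{p\mathbf v-\mathbf u}\text{ in }f^{p-1})_{\mathbf u,\mathbf v\in\mu_{\mathbb Z}}$ be the Hasse–Witt matrix. For a Frobenius lift $\sigma$ and a derivation $\delta$ of $R$ consider the matrices $\Lambda_\sigma,N_\delta\in R^{h\times h}$ defined by $$\mathscr C_p(\omega_{\mathbf u})\equiv\sum_{\mathbf v\in\mu_{\mathbb Z}}(\Lambda_\sigma)_{\mathbf u,\mathbf v}\,\omega^\sigma_{\mathbf v} \bmod U_{f^\sigma}(\mu),\qquad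 \delta(\omega_{\mathbf u})\equiv\sum_{\mathbf v\in\mu_{\mathbb Z}}(N_\delta)_{\mathbf u,\mathbf v}\,\omega_{\mathbf v}\bmod U_f(\mu)\qquad(\mathbf u\in\mu_{\mathbb Z}).$$ For a Laurent polynomial $g\in R[x_1^{\pm1},\dots,x_n^{\pm1}]$ and $m\ge1$ let $\rho_{m,g}(\omega)$ be the constant term of $g^m\omega$, and let $\boldsymbol\rho_m\in R^h$ be the column vector with components $\rho_{m,g}(\omega_{\mathbf u})$, $\mathbf u\in\mu_{\mathbb Z}$. **Theorem.** Suppose that $\beta_p(\mu)$ is invertible over $R$. Let $g$ be a Laurent polynomial over $R$, $\sigma$ a Frobenius lift and $\delta$ a derivation of $R$. If $p$ is odd, then matrices $\Lambda_\sigma$ and $N_\delta$ with the defining properties above exist and are unique. For every prime $p$, any matrices $\Lambda_\sigma$ and $N_\delta$ with these defining properties satisfy $$\boldsymbol\rho_m\equiv\Lambda_\sigma\,\sigma(\boldsymbol\rho_{m/p})\pmod{p^{\mathrm{ord}_p(m)}},\qquad \delta(\boldsymbol\rho_m)\equiv N_\delta\,\boldsymbol\rho_m\pmod{p^{\mathrm{ord}_p(m)}}$$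 for all $m\ge1$ (the first congruence being empty when $p\nmid m$). -/

import Mathlib

open scoped Pointwise

namespace DworkCrystals

noncomputable section

/-- Laurent polynomials over `R` in the variables `x_1, …, x_n`: the group ring of `ℤⁿ`. -/
abbrev Laurent (R : Type*) [CommRing R] (n : ℕ) : Type _ := AddMonoidAlgebra R (Fin n → ℤ)

/-- Formal Laurent series `∑ a_k x^k` (with arbitrary support), as coefficient functions. -/
abbrev Formal (R : Type*) (n : ℕ) : Type _ := (Fin n → ℤ) → R

/-- An integral exponent vector as a point of `ℝⁿ`. -/
def toReal {n : ℕ} (u : Fin n → ℤ) : Fin n → ℝ := fun i => (u i : ℝ)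

/-! ### Newton polytopes and open subsets -/

/-- The Newton polytope of `f`: the convex hull of its exponent vectors. -/
def newtonPolytope {R : Type*} [CommRing R] {n : ℕ} (f : Laurent R n) : Set (Fin n → ℝ) :=
  convexHull ℝ (toReal '' (f.coeff.support : Set (Fin n → ℤ)))

/-- `μ ⊆ Δ` is open: its complement in the polytope `Δ` is a union of faces of `Δ`
(the faces of a polytope are its exposed subsets). -/
def IsOpenSubset {n : ℕ} (Δ μ : Set (Fin n → ℝ)) : Prop :=
  μ ⊆ Δ ∧ ∃ S : Set (Set (Fin n → ℝ)), (∀ F ∈ S, IsExposed ℝ Δ F) ∧ Δ \ μ = ⋃₀ S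

theorem finite_integralPoints {R : Type*} [CommRing R] {n : ℕ} (f : Laurent R n)
    (μ : Set (Fin n → ℝ)) :
    {u : Fin n → ℤ | toReal u ∈ newtonPolytope f ∧ toReal u ∈ μ}.Finite := by
  have hb : Bornology.IsBounded (newtonPolytope f) :=
    isBounded_convexHull.2 ((f.coeff.support.finite_toSet.image _).isBounded)
  obtain ⟨C, hC⟩ := hb.exists_norm_le
  refine (Set.finite_Icc (fun _ : Fin n => -⌈C⌉) (fun _ => ⌈C⌉)).subset ?_
  rintro u ⟨hu, -⟩
  have key : ∀ i, |(u i : ℝ)| ≤ (⌈C⌉ : ℝ) := fun i =>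
    ((norm_le_pi_norm (toReal u) i).trans (hC _ hu)).trans (Int.le_ceil C)
  refine ⟨fun i => ?_, fun i => ?_⟩
  · exact_mod_cast (abs_le.1 (key i)).1
  · exact_mod_cast (abs_le.1 (key i)).2

/-- `μ_ℤ`, the integral points of a subset `μ` of the Newton polytope of `f`. -/
def integralPoints {R : Type*} [CommRing R] {n : ℕ} (f : Laurent R n)
    (μ : Set (Fin n → ℝ)) : Finset (Fin n → ℤ) :=
  (finite_integralPoints f μ).toFinset

/-! ### Rational functions through their expansions at a vertex -/

section Expansions

variable {R : Type*} [CommRing R] {n : ℕ}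

/-- The Laurent series expansion of the rational function `g / f ^ k` at the vertex `b` of the
Newton polytope of `f`, where `f_b` is a unit: writing `f = f_b x^b (1 + h)`, it is
`f_b⁻ᵏ x^(-kb) g ∑_{r ≥ 0} (-k choose r) h ^ r`. For a vertex `b`, only finitely many `r`
contribute to any given coefficient. -/
def expansion (b : Fin n → ℤ) (f g : Laurent R n) (k : ℕ) : Formal R n :=
  fun e => ∑ᶠ r : ℕ, ((Ring.choose (-(k : ℤ)) r : ℤ) : R) *
    (AddMonoidAlgebra.single (-(k • b)) (Ring.inverse (f.coeff b) ^ k) * g *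
      (AddMonoidAlgebra.single (-b) (Ring.inverse (f.coeff b)) * f - 1) ^ r).coeff e

/-- The form `ω_u = x^u / f`. -/
def omega (b : Fin n → ℤ) (f : Laurent R n) (u : Fin n → ℤ) : Formal R n :=
  expansion b f (AddMonoidAlgebra.single u 1) 1

/-- The `R`-module `Ω_f(μ)` of all rational functions `(k-1)! g / f ^ k` with `k ≥ 1` and
`supp g ⊆ k μ`. -/
def Omega (b : Fin n → ℤ) (μ : Set (Fin n → ℝ)) (f : Laurent R n) :
    Submodule R (Formal R n) :=
  Submodule.span R {ω | ∃ (k : ℕ) (g : Laurent R n), 1 ≤ k ∧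
    (∀ u ∈ g.coeff.support, toReal u ∈ (k : ℝ) • μ) ∧
    ω = ((k - 1).factorial : R) • expansion b f g k}

/-- The `p`-adic completion of `Ω_f(μ)`, realised inside formal series: those formal series which
are the `p`-adic limit of an element of the completion of `Ω_f(μ)`. (The topology is the `p`-adic
one of `Ω_f(μ)`, which is finer than the one induced from formal series.) -/
def completedOmega (p : ℕ) (b : Fin n → ℤ) (μ : Set (Fin n → ℝ)) (f : Laurent R n) :
    Submodule R (Formal R n) :=
  ((LinearMap.range (AdicCompletion.map (Ideal.span {(p : R)})
    (Omega b μ f).subtype)).restrictScalars R).comap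
      (AdicCompletion.of (Ideal.span {(p : R)}) (Formal R n))

/-- The Cartier operator `∑ a_k x^k ↦ ∑ a_{pk} x^k`. -/
def cartier (R : Type*) [CommRing R] (n p : ℕ) : Formal R n →ₗ[R] Formal R n :=
  LinearMap.funLeft R R (fun k : Fin n → ℤ => p • k)

/-- `σ` is a Frobenius lift: a ring endomorphism with `σ(r) ≡ r ^ p mod p`. -/
def IsFrobeniusLift (p : ℕ) (σ : R →+* R) : Prop :=
  ∀ r : R, (p : R) ∣ σ r - r ^ p

/-- `f^σ`: the endomorphism `σ` applied to the coefficients of `f`. -/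
def twist (σ : R →+* R) (f : Laurent R n) : Laurent R n :=
  AddMonoidAlgebra.mapRingHom (Fin n → ℤ) σ f

/-- `U_f(μ)`: the elements `ω` of the completion of `Ω_f(μ)` such that the `s`-th iterate of the
Cartier operator maps `ω` into `p ^ s` times the completion of `Ω_{f^(σ^s)}(μ)`, for all
`s ≥ 1`. -/
def formalDerivatives (p : ℕ) (b : Fin n → ℤ) (μ : Set (Fin n → ℝ)) (σ : R →+* R)
    (f : Laurent R n) : Set (Formal R n) :=
  {ω | ω ∈ completedOmega p b μ f ∧ ∀ s : ℕ, 1 ≤ s →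
    ∃ η ∈ completedOmega p b μ ((twist σ)^[s] f), (cartier R n p)^[s] ω = (p : R) ^ s • η}

/-- The Hasse–Witt matrix `β_p(μ)`, whose entry at `(u, v)` is the coefficient of `x^(pv-u)` in
`f ^ (p-1)`. -/
def hasseWitt (p : ℕ) (μ : Set (Fin n → ℝ)) (f : Laurent R n) :
    Matrix (integralPoints f μ) (integralPoints f μ) R :=
  Matrix.of fun u v => (f ^ (p - 1)).coeff (p • (v : Fin n → ℤ) - u)

/-- `Λ` is the matrix of the Cartier operator:
`C_p(ω_u) ≡ ∑_v Λ_{u,v} ω_v^σ mod U_{f^σ}(μ)`, where `ω_v^σ = x^v / f^σ`. -/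
def IsCartierMatrix (p : ℕ) (b : Fin n → ℤ) (μ : Set (Fin n → ℝ)) (σ : R →+* R)
    (f : Laurent R n) (Λ : Matrix (integralPoints f μ) (integralPoints f μ) R) : Prop :=
  ∀ u : integralPoints f μ, cartier R n p (omega b f u) - ∑ v : integralPoints f μ, Λ u v • omega b (twist σ f) v ∈
    formalDerivatives p b μ σ (twist σ f)

/-- `N` is the matrix of the derivation `δ` (acting on coefficients):
`δ(ω_u) ≡ ∑_v N_{u,v} ω_v mod U_f(μ)`. -/
def IsDerivationMatrix (p : ℕ) (b : Fin n → ℤ) (μ : Set (Fin n → ℝ)) (σ : R →+* R)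
    (δ : Derivation ℤ R R) (f : Laurent R n)
    (N : Matrix (integralPoints f μ) (integralPoints f μ) R) : Prop :=
  ∀ u : integralPoints f μ, (fun e => δ (omega b f u e)) - ∑ v : integralPoints f μ, N u v • omega b f v ∈
    formalDerivatives p b μ σ f

/-- The constant term of the product of a Laurent polynomial `g` and a formal series `ω`. -/
def constantTerm (g : Laurent R n) (ω : Formal R n) : R :=
  ∑ w ∈ g.coeff.support, g.coeff w * ω (-w)

/-- The vector `ρ_m` of the periods `ρ_{m,g}(ω_u)`, where `ρ_{m,g}(ω)` is the constant term of
`g ^ m ω`. -/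
def periodVector (b : Fin n → ℤ) (μ : Set (Fin n → ℝ)) (f g : Laurent R n) (m : ℕ) :
    integralPoints f μ → R :=
  fun u => constantTerm (g ^ m) (omega b f u)

end Expansions

end

end DworkCrystals

/-! A linear functional that is smallest on the support of `f` at `b` only makes multiplication by
`f` injective on series bounded below, even modulo any `c`. Hence g/f^k is the unique bounded-below
series ω with f^k ω = g, and identities or divisibilities between rational functions are checked
after clearing denominators.

Write F = f^σ. The Frobenius lift gives f^p = F(x^p) + pG. Expanding f^(-pk) in powers of pG, and
using C_p(h(x^p) ω) = h C_p(ω), expresses C_p of a rational function through fractions with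
denominators F^(k+r). The factor (k-1)! in Ω_f turns the binomial coefficients into p^r/r!, which is
divisible by p for r ≥ 1. So C_p maps everything into the span of the ω_v^σ modulo p, and on the ω_u
its matrix modulo p is the Hasse–Witt matrix (`IsExpansionSum.exists_cartier_eq`). If that matrix is
invertible, successive approximation splits each element as a combination of the ω_u plus a
remainder ξ with p^s ∣ C_p^s(ξ) for all s (`exists_unitRoot_decomposition`), and the coefficients
are unique (`eq_zero_of_pow_dvd_iterate`).

For odd p the quotients p^r/r! tend to 0 fast enough to stay in the completion of Ω_f, so existence
follows. For p = 2 this estimate fails; the argument then runs in the larger module of series ∑ j!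
g_j/f^(j+1), which converge because p^N ∣ (pN)!. The congruences only use divisibility in formal
series, so they hold for every p.

Periods: if p^s ∣ q, then g^(pq) ≡ g^σ(x^p)^q modulo p^(s+1), so the constant term of g^(pq) ω
agrees modulo p^(s+1) with that of (g^σ)^q C_p(ω). Iterating, a remainder ξ as above has period
divisible by p^(ord m) (`pow_dvd_constantTerm_pow`). With δ(g^m) = m g^(m-1) δ(g) this gives the
congruence for N. For Λ one more factor p is needed: by uniqueness of the coefficients the remainder
of C_p(ω_u) is p times such a ξ (`exists_eq_smul_of_cartier_omega_sub_mem`). -/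

open scoped Pointwise

namespace DworkCrystals

noncomputable section

/-! ### Laurent polynomials acting on formal series; cancellation of `f`. -/

section Action

variable {R : Type*} [CommRing R] {n : ℕ}

/-- The formal series all of whose coefficients are divisible by `c`. -/
def multiples (n : ℕ) (c : R) : Submodule R (Formal R n) where
  carrier := {ω | ∀ e, c ∣ ω e}
  add_mem' h₁ h₂ e := dvd_add (h₁ e) (h₂ e)
  zero_mem' _ := dvd_zero c
  smul_mem' r _ h e := (h e).mul_left r

theorem mem_multiples {c : R} {ω : Formal R n} : ω ∈ multiples n c ↔ ∀ e, c ∣ ω e := Iff.rfl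

theorem mem_multiples_iff_exists {c : R} {ω : Formal R n} :
    ω ∈ multiples n c ↔ ∃ η : Formal R n, ω = c • η := by
  refine ⟨fun h => ?_, ?_⟩
  · choose η hη using h
    exact ⟨η, funext hη⟩
  · rintro ⟨η, rfl⟩ e
    exact dvd_mul_right _ _

theorem smul_mem_multiples (c : R) (ω : Formal R n) : c • ω ∈ multiples n c :=
  fun _ => dvd_mul_right _ _

theorem multiples_anti {c d : R} (h : c ∣ d) : multiples n d ≤ multiples n c :=
  fun _ hω e => h.trans (hω e)

theorem smul_mem_multiples_mul {c d : R} {ω : Formal R n} (h : ω ∈ multiples n d) :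
    c • ω ∈ multiples n (c * d) := fun e => mul_dvd_mul_left c (h e)

theorem mem_multiples_of_smul [IsDomain R] {c d : R} (hc : c ≠ 0) {ω : Formal R n}
    (h : c • ω ∈ multiples n (c * d)) : ω ∈ multiples n d :=
  fun e => (mul_dvd_mul_iff_left hc).1 (h e)

theorem multiples_zero {ω : Formal R n} : ω ∈ multiples n (0 : R) ↔ ω = 0 := by
  simp [mem_multiples, funext_iff]

/-- Laurent polynomials act on formal series by multiplication. -/
def act : Laurent R n →ₐ[R] Module.End R (Formal R n) :=
  AddMonoidAlgebra.lift R (Module.End R (Formal R n)) (Fin n → ℤ)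
    { toFun := fun w => LinearMap.funLeft R R (fun e => e - w.toAdd)
      map_one' := by ext ω e; simp [LinearMap.funLeft]
      map_mul' := fun v w => by ext ω e; simp [LinearMap.funLeft, sub_sub] }

theorem act_single (w : Fin n → ℤ) (c : R) (ω : Formal R n) (e : Fin n → ℤ) :
    act (AddMonoidAlgebra.single w c) ω e = c * ω (e - w) := by
  simp [act, LinearMap.funLeft]

theorem act_apply (g : Laurent R n) (ω : Formal R n) (e : Fin n → ℤ) :
    act g ω e = ∑ w ∈ g.coeff.support, g.coeff w * ω (e - w) := by
  conv_lhs => rw [← AddMonoidAlgebra.sum_coeff_single g]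
  rw [Finsupp.sum, map_sum, LinearMap.sum_apply, Finset.sum_apply]
  exact Finset.sum_congr rfl fun w _ => act_single _ _ _ _

theorem act_mul (g h : Laurent R n) (ω : Formal R n) : act (g * h) ω = act g (act h ω) := by
  rw [map_mul]; rfl

theorem constantTerm_eq (g : Laurent R n) (ω : Formal R n) : constantTerm g ω = act g ω 0 := by
  simp [constantTerm, act_apply]

theorem act_coeff (g h : Laurent R n) : act g (h.coeff : Formal R n) = ⇑(g * h).coeff := by
  induction g using AddMonoidAlgebra.induction_linear with
  | zero => simp
  | add x y hx hy => simp [hx, hy, add_mul]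
  | single w c =>
    funext e
    rw [act_single, AddMonoidAlgebra.coeff_single_mul_apply, sub_eq_neg_add]

theorem act_mem_multiples (g : Laurent R n) {c : R} {ω : Formal R n} (h : ω ∈ multiples n c) :
    act g ω ∈ multiples n c := by
  obtain ⟨η, rfl⟩ := mem_multiples_iff_exists.1 h
  rw [map_smul]
  exact smul_mem_multiples _ _

/-- The formal series whose support is bounded below with respect to a linear functional. -/
def boundedBelow (R : Type*) [CommRing R] {n : ℕ} (ℓ : (Fin n → ℤ) →+ ℝ) :
    Submodule R (Formal R n) where
  carrier := {ω | ∃ c : ℝ, ∀ e, ω e ≠ 0 → c ≤ ℓ e}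
  add_mem' := by
    rintro x y ⟨c, hc⟩ ⟨d, hd⟩
    refine ⟨min c d, fun e he => ?_⟩
    by_cases hx : x e = 0
    · exact (min_le_right _ _).trans (hd e fun hy => he (by simp [hx, hy]))
    · exact (min_le_left _ _).trans (hc e hx)
  zero_mem' := ⟨0, fun e he => absurd rfl he⟩
  smul_mem' r x := by
    rintro ⟨c, hc⟩
    exact ⟨c, fun e he => hc e fun hx => he (by simp [hx])⟩

theorem coeff_mem_boundedBelow (ℓ : (Fin n → ℤ) →+ ℝ) (g : Laurent R n) :
    (g.coeff : Formal R n) ∈ boundedBelow R ℓ := by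
  obtain ⟨c, hc⟩ := ((g.coeff.support.finite_toSet.image ℓ)).bddBelow
  exact ⟨c, fun e he => hc ⟨e, by simpa using he, rfl⟩⟩

theorem act_mem_boundedBelow (ℓ : (Fin n → ℤ) →+ ℝ) (g : Laurent R n) {ω : Formal R n}
    (h : ω ∈ boundedBelow R ℓ) : act g ω ∈ boundedBelow R ℓ := by
  obtain ⟨c, hc⟩ := h
  obtain ⟨d, hd⟩ := coeff_mem_boundedBelow ℓ g
  refine ⟨d + c, fun e he => ?_⟩
  rw [act_apply] at he
  obtain ⟨w, -, hw⟩ := Finset.exists_ne_zero_of_sum_ne_zero he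
  have h1 := hd w (left_ne_zero_of_mul hw)
  have h2 := hc _ (right_ne_zero_of_mul hw)
  rw [map_sub] at h2
  linarith

/-- The coefficient of `f` at `b` is a unit, and `ℓ` attains its minimum on the support of `f` at
`b` only. -/
structure IsVertex (ℓ : (Fin n → ℤ) →+ ℝ) (b : Fin n → ℤ) (f : Laurent R n) : Prop where
  isUnit : IsUnit (f.coeff b)
  lt : ∀ w ∈ f.coeff.support, w ≠ b → ℓ b < ℓ w

variable {ℓ : (Fin n → ℤ) →+ ℝ} {b : Fin n → ℤ} {f : Laurent R n}

theorem IsVertex.exists_gap (hf : IsVertex ℓ b f) :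
    ∃ ε > 0, ∀ w ∈ f.coeff.support, w ≠ b → ℓ b + ε ≤ ℓ w := by
  classical
  rcases (f.coeff.support.erase b).eq_empty_or_nonempty with h | h
  · refine ⟨1, one_pos, fun w hw hwb => absurd (Finset.mem_erase.2 ⟨hwb, hw⟩) (by simp [h])⟩
  · obtain ⟨v, hv, hmin⟩ := Finset.exists_min_image _ ℓ h
    have hv' := Finset.mem_erase.1 hv
    refine ⟨ℓ v - ℓ b, sub_pos.2 (hf.lt v hv'.2 hv'.1), fun w hw hwb => ?_⟩
    linarith [hmin w (Finset.mem_erase.2 ⟨hwb, hw⟩)]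

/-- The coefficient of fω at e + b is f_b ω_e plus coefficients of ω at exponents whose ℓ-value is
smaller by at least the gap ε. Since f_b is a unit and ω vanishes below some level, divisibility
propagates upwards in steps of ε. -/
theorem IsVertex.mem_multiples_of_act (hf : IsVertex ℓ b f) {c : R} {ω : Formal R n}
    (hω : ω ∈ boundedBelow R ℓ) (h : act f ω ∈ multiples n c) : ω ∈ multiples n c := by
  classical
  obtain ⟨ε, hε, hgap⟩ := hf.exists_gap
  obtain ⟨d, hd⟩ := hω
  have key : ∀ (k : ℕ) (e), ℓ e < d + k * ε → c ∣ ω e := by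
    intro k
    induction k with
    | zero =>
      intro e he
      have : ω e = 0 := by
        by_contra hne
        have := hd e hne
        simp at he
        linarith
      simp [this]
    | succ k ih =>
      intro e he
      have h1 := h (e + b)
      rcases subsingleton_or_nontrivial R with hs | hs
      · exact (Subsingleton.elim (ω e) 0) ▸ dvd_zero c
      have hbs : b ∈ f.coeff.support := by simpa using hf.isUnit.ne_zero
      rw [act_apply, ← Finset.add_sum_erase _ _ hbs, add_sub_cancel_right] at h1
      have h2 : c ∣ ∑ w ∈ f.coeff.support.erase b, f.coeff w * ω (e + b - w) := by
        refine Finset.dvd_sum fun w hw => (ih _ ?_).mul_left _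
        obtain ⟨hwb, hw⟩ := Finset.mem_erase.1 hw
        have := hgap w hw hwb
        rw [map_sub, map_add]
        push_cast at he
        linarith
      exact (hf.isUnit.dvd_mul_left).1 ((dvd_add_left h2).1 h1)
  intro e
  obtain ⟨k, hk⟩ := exists_nat_gt ((ℓ e - d) / ε)
  refine key k e ?_
  rw [div_lt_iff₀ hε] at hk
  linarith

theorem IsVertex.mem_multiples_of_act_pow (hf : IsVertex ℓ b f) {c : R} (k : ℕ) {ω : Formal R n}
    (hω : ω ∈ boundedBelow R ℓ) (h : act (f ^ k) ω ∈ multiples n c) : ω ∈ multiples n c := by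
  induction k with
  | zero => simpa using h
  | succ k ih =>
    rw [pow_succ', act_mul] at h
    exact ih (hf.mem_multiples_of_act (act_mem_boundedBelow ℓ _ hω) h)

theorem IsVertex.eq_of_act_pow (hf : IsVertex ℓ b f) (k : ℕ) {ω η : Formal R n}
    (hω : ω ∈ boundedBelow R ℓ) (hη : η ∈ boundedBelow R ℓ)
    (h : act (f ^ k) ω = act (f ^ k) η) : ω = η := by
  refine sub_eq_zero.1 (multiples_zero.1 ?_)
  refine hf.mem_multiples_of_act_pow k (sub_mem hω hη) ?_
  rw [map_sub, h, sub_self]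
  exact zero_mem _

end Action

/-- The sum is the binomial series of (x + y)^(-k) truncated at order m, times x^(k+m). It is used
twice: for 1 + h, to expand at the vertex, and for F(x^p) + pG, to compute C_p. -/
theorem exists_add_pow_mul_sum_choose_neg {S : Type*} [CommRing S] (x y : S) (k m : ℕ) :
    ∃ q, (x + y) ^ k * ∑ r ∈ Finset.range m,
      ((Ring.choose (-(k : ℤ)) r : ℤ) : S) * x ^ (m - r) * y ^ r = x ^ (k + m) + y ^ m * q := by
  rcases Nat.eq_zero_or_pos m with rfl | hm
  · exact ⟨-x ^ k, by simp⟩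
  obtain ⟨m, rfl⟩ : ∃ j, m = j + 1 := ⟨m - 1, by omega⟩
  induction k with
  | zero =>
    refine ⟨0, ?_⟩
    rw [Finset.sum_range_succ']
    simp [Ring.choose_zero_succ]
  | succ k ih =>
    obtain ⟨q, hq⟩ := ih
    set c : ℕ → ℤ := fun r => Ring.choose (-((k + 1 : ℕ) : ℤ)) r with hc
    set d : ℕ → ℤ := fun r => Ring.choose (-(k : ℤ)) r with hd
    have hcd : ∀ r, d (r + 1) = c r + c (r + 1) := by
      intro r
      have := Ring.choose_succ_succ (-((k + 1 : ℕ) : ℤ)) r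
      rw [show -((k + 1 : ℕ) : ℤ) + 1 = -(k : ℤ) by push_cast; ring] at this
      exact this
    -- Pascal's rule `hcd` makes the product telescope. The slack exponent i lets the induction on j
    -- absorb the extra x at each step; only i = 0 is used.
    have key : ∀ j, ∀ i, (x + y) * ∑ r ∈ Finset.range (j + 1), (c r : S) * x ^ (j + 1 + i - r) * y ^ r
        = x * ∑ r ∈ Finset.range (j + 1), (d r : S) * x ^ (j + 1 + i - r) * y ^ r
          + (c j : S) * x ^ (1 + i) * y ^ (j + 1) := by
      intro j
      induction j with
      | zero => intro i; simp [hc, hd]; ring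
      | succ j ihj =>
        intro i
        rw [Finset.sum_range_succ, Finset.sum_range_succ _ (j + 1), mul_add, mul_add]
        have := ihj (i + 1)
        rw [show j + 1 + (i + 1) = j + 1 + 1 + i by ring] at this
        rw [this, hcd, show j + 1 + 1 + i - (j + 1) = 1 + i by omega]
        push_cast
        ring
    have := key m 0
    rw [add_zero] at this
    refine ⟨x * q + (x + y) ^ k * ((c m : S) * x), ?_⟩
    calc _ = (x + y) ^ k * ((x + y) * ∑ r ∈ Finset.range (m + 1), (c r : S) * x ^ (m + 1 - r) * y ^ r) := by
          rw [pow_succ, mul_assoc]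
      _ = x * ((x + y) ^ k * ∑ r ∈ Finset.range (m + 1), (d r : S) * x ^ (m + 1 - r) * y ^ r)
          + (x + y) ^ k * ((c m : S) * x) * y ^ (m + 1) := by rw [this]; ring
      _ = _ := by rw [hq]; ring

/-! ### Expansions at the vertex and their characterisation by clearing denominators. -/

section Expansion

variable {R : Type*} [CommRing R] {n : ℕ} {ℓ : (Fin n → ℤ) →+ ℝ} {b : Fin n → ℤ}
  {f g : Laurent R n}

theorem exists_of_coeff_mul_ne_zero {g h : Laurent R n} {e : Fin n → ℤ}
    (he : (g * h).coeff e ≠ 0) : ∃ v w, g.coeff v ≠ 0 ∧ h.coeff w ≠ 0 ∧ e = v + w := by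
  classical
  rw [← act_coeff, act_apply] at he
  obtain ⟨w, -, hw⟩ := Finset.exists_ne_zero_of_sum_ne_zero he
  exact ⟨w, e - w, left_ne_zero_of_mul hw, right_ne_zero_of_mul hw, by abel⟩

theorem le_of_coeff_pow_ne_zero {h : Laurent R n} {ε : ℝ} (hh : ∀ e, h.coeff e ≠ 0 → ε ≤ ℓ e)
    (r : ℕ) : ∀ e, (h ^ r).coeff e ≠ 0 → r * ε ≤ ℓ e := by
  induction r with
  | zero =>
    intro e he
    have : e = 0 := by
      by_contra hne
      exact he (by simp [AddMonoidAlgebra.one_def, Ne.symm hne])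
    simp [this]
  | succ r ih =>
    intro e he
    obtain ⟨v, w, hv, hw, rfl⟩ := exists_of_coeff_mul_ne_zero (pow_succ h r ▸ he)
    have h1 := ih v hv
    have h2 := hh w hw
    rw [map_add]
    push_cast
    linarith

/-- The Laurent polynomials supported in the half space where `ℓ` is nonnegative. -/
def nonnegSubring (R : Type*) [CommRing R] {n : ℕ} (ℓ : (Fin n → ℤ) →+ ℝ) :
    Subring (Laurent R n) where
  carrier := {x | ∀ e, x.coeff e ≠ 0 → 0 ≤ ℓ e}
  mul_mem' hx hy e he := by
    obtain ⟨v, w, hv, hw, rfl⟩ := exists_of_coeff_mul_ne_zero he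
    rw [map_add]
    exact add_nonneg (hx v hv) (hy w hw)
  one_mem' e he := by
    have : e = 0 := by
      by_contra hne
      exact he (by simp [AddMonoidAlgebra.one_def, Ne.symm hne])
    simp [this]
  add_mem' {x y} hx hy e he := by
    by_cases h : x.coeff e = 0
    · exact hy e fun h' => he (by simp [h, h'])
    · exact hx e h
  zero_mem' e he := absurd rfl he
  neg_mem' {x} hx e he := hx e fun h => he (by simp [h])

/-- These two properties determine the expansion, and later arguments use them instead of the
defining infinite sum. They hold because h has ℓ-values at least ε > 0, so only finitely many h^r
reach a given exponent. -/
theorem IsVertex.expansion_spec (hf : IsVertex ℓ b f) (g : Laurent R n) (k : ℕ) :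
    expansion b f g k ∈ boundedBelow R ℓ ∧ act (f ^ k) (expansion b f g k) = g.coeff := by
  classical
  set u := Ring.inverse (f.coeff b) with hu
  have hu1 : f.coeff b * u = 1 := Ring.mul_inverse_cancel _ hf.isUnit
  set h : Laurent R n := AddMonoidAlgebra.single (-b) u * f - 1 with hh
  set a : Laurent R n := AddMonoidAlgebra.single (-(k • b)) (u ^ k) * g with ha
  obtain ⟨ε, hε, hgap⟩ := hf.exists_gap
  have hsupp : ∀ e, h.coeff e ≠ 0 → ε ≤ ℓ e := by
    intro e he
    have h1 : h.coeff e = u * f.coeff (b + e) - (1 : Laurent R n).coeff e := by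
      rw [hh, AddMonoidAlgebra.coeff_sub, Finsupp.sub_apply,
        AddMonoidAlgebra.coeff_single_mul_apply, neg_neg]
    by_cases he0 : e = 0
    · refine absurd ?_ he
      rw [h1, he0, add_zero, mul_comm u, hu1]
      simp [AddMonoidAlgebra.one_def]
    · have h2 : f.coeff (b + e) ≠ 0 := by
        intro h0
        exact he (by rw [h1, h0]; simp [AddMonoidAlgebra.one_def, Ne.symm he0])
      have h3 := hgap (b + e) (by simpa using h2) (by simpa using he0)
      rw [map_add] at h3
      linarith
  have hpow := le_of_coeff_pow_ne_zero hsupp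
  have hmul : f = AddMonoidAlgebra.single b (f.coeff b) * (1 + h) := by
    rw [hh, add_sub_cancel, ← mul_assoc, AddMonoidAlgebra.single_mul_single, hu1, add_neg_cancel,
      ← AddMonoidAlgebra.one_def, one_mul]
  obtain ⟨c, hc⟩ := coeff_mem_boundedBelow ℓ a
  have hah : ∀ (r : ℕ) e, (a * h ^ r).coeff e ≠ 0 → c + r * ε ≤ ℓ e := by
    intro r e he
    obtain ⟨v, w, hv, hw, rfl⟩ := exists_of_coeff_mul_ne_zero he
    rw [map_add]
    linarith [hc v hv, hpow r w hw]
  have hlarge : ∀ (c d : ℝ), ∃ N : ℕ, ∀ r : ℕ, N ≤ r → d < c + r * ε := by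
    intro c d
    obtain ⟨N, hN⟩ := exists_nat_gt ((d - c) / ε)
    refine ⟨N, fun r hr => ?_⟩
    have : (d - c) / ε < r := hN.trans_le (by exact_mod_cast hr)
    rw [div_lt_iff₀ hε] at this
    linarith
  have hsum : ∀ e (N : ℕ), (∀ r : ℕ, N ≤ r → ℓ e < c + r * ε) → expansion b f g k e =
      (∑ r ∈ Finset.range N,
        ((Ring.choose (-(k : ℤ)) r : ℤ) : Laurent R n) * (a * h ^ r)).coeff e := by
    intro e N hN
    have hcast : ∀ (z : ℤ) (x : Laurent R n), ((z : Laurent R n) * x).coeff e = (z : R) * x.coeff e := by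
      intro z x
      rw [← zsmul_eq_mul, ← Int.cast_smul_eq_zsmul R, AddMonoidAlgebra.coeff_smul_apply, smul_eq_mul]
    rw [AddMonoidAlgebra.coeff_sum, Finsupp.finsetSum_apply, expansion]
    simp_rw [hcast]
    refine finsum_eq_sum_of_support_subset _ fun r hr => ?_
    rw [Function.mem_support] at hr
    by_contra hrN
    have h1 := hah r e (right_ne_zero_of_mul hr)
    have h2 := hN r (by simpa using hrN)
    linarith
  refine ⟨⟨c, fun e he => ?_⟩, ?_⟩
  · by_contra hlt
    push Not at hlt
    refine he ?_
    rw [hsum e 0 fun r _ => ?_]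
    · simp
    · have : (0 : ℝ) ≤ r * ε := by positivity
      linarith
  · funext e
    have hbd : ∃ D : ℝ, ℓ e ≤ D ∧ ∀ w ∈ (f ^ k).coeff.support, ℓ (e - w) ≤ D := by
      obtain ⟨D, hD⟩ := ((f ^ k).coeff.support.finite_toSet.image fun w => ℓ (e - w)).bddAbove
      exact ⟨max (ℓ e) D, le_max_left _ _, fun w hw =>
        (hD ⟨w, by simpa using hw, rfl⟩).trans (le_max_right _ _)⟩
    obtain ⟨D, hDe, hD⟩ := hbd
    obtain ⟨c', hc'⟩ := coeff_mem_boundedBelow ℓ g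
    obtain ⟨N₁, hN₁⟩ := hlarge c D
    obtain ⟨N₂, hN₂⟩ := hlarge c' D
    set N := max N₁ N₂ with hN
    have h1 : act (f ^ k) (expansion b f g k) e = (f ^ k * ∑ r ∈ Finset.range N,
        ((Ring.choose (-(k : ℤ)) r : ℤ) : Laurent R n) * (a * h ^ r)).coeff e := by
      rw [← act_coeff, act_apply, act_apply]
      refine Finset.sum_congr rfl fun w hw => ?_
      rw [hsum (e - w) N fun r hr => ?_]
      exact (hD w hw).trans_lt (hN₁ r ((le_max_left _ _).trans hr))
    -- The identity is applied inside the subring so that the cofactor q also has nonnegative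
    -- ℓ-values; the error g h^N q then has no coefficient at e once N is large.
    let hV : nonnegSubring R ℓ := ⟨h, fun e he => hε.le.trans (hsupp e he)⟩
    obtain ⟨q, hq⟩ := exists_add_pow_mul_sum_choose_neg 1 hV k N
    replace hq := congrArg (Subring.subtype _) hq
    simp only [map_mul, map_add, map_sum, map_pow, map_one, map_intCast, one_pow, mul_one,
      Subring.subtype_apply] at hq
    change (1 + h) ^ k * _ = 1 + h ^ N * (q : Laurent R n) at hq
    have h2 : (f ^ k * ∑ r ∈ Finset.range N,
        ((Ring.choose (-(k : ℤ)) r : ℤ) : Laurent R n) * (a * h ^ r)) =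
        g + g * h ^ N * (q : Laurent R n) := by
      have h3 : f ^ k * a = (1 + h) ^ k * g := by
        rw [ha]
        nth_rewrite 1 [hmul]
        rw [mul_pow, AddMonoidAlgebra.single_pow, mul_comm _ ((1 + h) ^ k), mul_assoc, ← mul_assoc _ _ g,
          AddMonoidAlgebra.single_mul_single, ← mul_pow, hu1, one_pow, add_neg_cancel,
          ← AddMonoidAlgebra.one_def, one_mul]
      calc _ = f ^ k * a * ∑ r ∈ Finset.range N,
            ((Ring.choose (-(k : ℤ)) r : ℤ) : Laurent R n) * h ^ r := by
            rw [mul_assoc, Finset.mul_sum _ _ a]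
            congr 1
            exact Finset.sum_congr rfl fun r _ => by ring
        _ = g * ((1 + h) ^ k * ∑ r ∈ Finset.range N,
            ((Ring.choose (-(k : ℤ)) r : ℤ) : Laurent R n) * h ^ r) := by rw [h3]; ring
        _ = _ := by
          refine (congrArg (g * ·) hq).trans ?_
          ring
    rw [h1, h2, AddMonoidAlgebra.coeff_add, Finsupp.add_apply, add_eq_left]
    by_contra hne
    obtain ⟨v, w, hv, hw, hvw⟩ := exists_of_coeff_mul_ne_zero hne
    obtain ⟨v₁, v₂, hv₁, hv₂, rfl⟩ := exists_of_coeff_mul_ne_zero hv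
    have h4 := hc' v₁ hv₁
    have h5 := hpow N v₂ hv₂
    have h6 := q.2 w hw
    have h7 := hN₂ N (le_max_right _ _)
    rw [hvw, map_add, map_add] at hDe
    linarith

theorem IsVertex.expansion_mem (hf : IsVertex ℓ b f) (g : Laurent R n) (k : ℕ) :
    expansion b f g k ∈ boundedBelow R ℓ := (hf.expansion_spec g k).1

theorem IsVertex.act_expansion (hf : IsVertex ℓ b f) (g : Laurent R n) (k : ℕ) :
    act (f ^ k) (expansion b f g k) = g.coeff := (hf.expansion_spec g k).2

theorem IsVertex.eq_expansion (hf : IsVertex ℓ b f) {g : Laurent R n} {k : ℕ} {ω : Formal R n}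
    (hω : ω ∈ boundedBelow R ℓ) (h : act (f ^ k) ω = g.coeff) : ω = expansion b f g k :=
  hf.eq_of_act_pow k hω (hf.expansion_mem g k) (h.trans (hf.act_expansion g k).symm)

theorem IsVertex.expansion_add (hf : IsVertex ℓ b f) (g h : Laurent R n) (k : ℕ) :
    expansion b f (g + h) k = expansion b f g k + expansion b f h k := by
  refine (hf.eq_expansion (add_mem (hf.expansion_mem g k) (hf.expansion_mem h k)) ?_).symm
  rw [map_add, hf.act_expansion, hf.act_expansion]
  rfl

theorem IsVertex.expansion_smul (hf : IsVertex ℓ b f) (c : R) (g : Laurent R n) (k : ℕ) :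
    expansion b f (c • g) k = c • expansion b f g k := by
  refine (hf.eq_expansion (Submodule.smul_mem _ c (hf.expansion_mem g k)) ?_).symm
  rw [map_smul, hf.act_expansion]
  rfl

/-- The expansion of `g / f ^ k`, as a linear map in the numerator `g`. -/
def IsVertex.expansionHom (hf : IsVertex ℓ b f) (k : ℕ) : Laurent R n →ₗ[R] Formal R n where
  toFun g := expansion b f g k
  map_add' g h := hf.expansion_add g h k
  map_smul' c g := hf.expansion_smul c g k

theorem IsVertex.expansion_pow_mul (hf : IsVertex ℓ b f) (g : Laurent R n) (j k : ℕ) :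
    expansion b f (f ^ j * g) (j + k) = expansion b f g k := by
  refine (hf.eq_expansion (hf.expansion_mem g k) ?_).symm
  rw [pow_add, act_mul, hf.act_expansion, act_coeff]

theorem IsVertex.expansion_mem_multiples (hf : IsVertex ℓ b f) {c : R} {g : Laurent R n}
    (hg : ∀ e, c ∣ g.coeff e) (k : ℕ) : expansion b f g k ∈ multiples n c := by
  refine hf.mem_multiples_of_act_pow k (hf.expansion_mem g k) ?_
  rw [hf.act_expansion]
  exact hg

end Expansion

/-! ### Supports in dilates of an open subset of the polytope. -/

section Supports

variable {R : Type*} [CommRing R] {n : ℕ}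

theorem toReal_add (u v : Fin n → ℤ) : toReal (u + v) = toReal u + toReal v := by
  funext i; simp [toReal]

theorem toReal_nsmul (k : ℕ) (u : Fin n → ℤ) : toReal (k • u) = (k : ℝ) • toReal u := by
  funext i; simp [toReal]

/-- The Laurent polynomials supported in the dilate `k μ`. -/
def suppIn (R : Type*) [CommRing R] {n : ℕ} (k : ℕ) (μ : Set (Fin n → ℝ)) :
    Submodule R (Laurent R n) where
  carrier := {g | ∀ u, g.coeff u ≠ 0 → toReal u ∈ (k : ℝ) • μ}
  add_mem' {x y} hx hy e he := by
    by_cases h : x.coeff e = 0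
    · exact hy e fun h' => he (by simp [h, h'])
    · exact hx e h
  zero_mem' e he := absurd rfl he
  smul_mem' r x hx e he := hx e fun h => he (by simp [h])

/-- A subset `μ` of `Δ` that contains the half-open segments from its points to points of `Δ`. -/
structure Absorbing (Δ μ : Set (Fin n → ℝ)) : Prop where
  subset : μ ⊆ Δ
  combo : ∀ x ∈ μ, ∀ y ∈ Δ, ∀ s t : ℝ, 0 < s → 0 ≤ t → s + t = 1 → s • x + t • y ∈ μ

/-- Exposed faces are extreme: if an inner point of a segment starting at x ∈ μ lay in a removed
face, x would lie in it as well. -/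
theorem IsOpenSubset.absorbing {Δ μ : Set (Fin n → ℝ)} (h : IsOpenSubset Δ μ)
    (hΔ : Convex ℝ Δ) : Absorbing Δ μ := by
  obtain ⟨hsub, S, hS, hU⟩ := h
  refine ⟨hsub, fun x hx y hy s t hs ht hst => ?_⟩
  rcases ht.eq_or_lt with rfl | ht
  · obtain rfl : s = 1 := by simpa using hst
    simpa using hx
  by_contra hz
  have hzΔ : s • x + t • y ∈ Δ := hΔ (hsub hx) hy hs.le ht.le hst
  obtain ⟨F, hF, hzF⟩ : s • x + t • y ∈ ⋃₀ S := hU ▸ ⟨hzΔ, hz⟩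
  have hxF : x ∈ F := (hS F hF).isExtreme.2 (hsub hx) hy hzF ⟨s, t, hs, ht, hst, rfl⟩
  exact (hU.symm ▸ (⟨F, hF, hxF⟩ : x ∈ ⋃₀ S) : x ∈ Δ \ μ).2 hx

/-- After rescaling, the sum is a convex combination with weights k/(k+l) and l/(k+l); k ≥ 1 keeps
the weight of the point of μ positive. -/
theorem Absorbing.add_mem {Δ μ : Set (Fin n → ℝ)} (h : Absorbing Δ μ) {k l : ℕ} (hk : 1 ≤ k)
    {x y : Fin n → ℝ} (hx : x ∈ (k : ℝ) • μ) (hy : y ∈ (l : ℝ) • Δ) :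
    x + y ∈ ((k + l : ℕ) : ℝ) • μ := by
  obtain ⟨x, hx, rfl⟩ := hx
  obtain ⟨y, hy, rfl⟩ := hy
  have hk' : (0 : ℝ) < k := by exact_mod_cast hk
  have hl' : (0 : ℝ) ≤ l := by positivity
  have hkl : (k + l : ℝ) ≠ 0 := by positivity
  refine ⟨(k / (k + l) : ℝ) • x + (l / (k + l) : ℝ) • y,
    h.combo x hx y hy _ _ (by positivity) (by positivity) (by field_simp), ?_⟩
  dsimp only
  rw [smul_add, smul_smul, smul_smul]
  push_cast
  rw [mul_div_cancel₀ _ hkl, mul_div_cancel₀ _ hkl]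

variable {Δ μ : Set (Fin n → ℝ)}

theorem Absorbing.mul_mem_suppIn (h : Absorbing Δ μ) {k l : ℕ} (hk : 1 ≤ k) {x y : Laurent R n}
    (hx : x ∈ suppIn R k μ) (hy : y ∈ suppIn R l Δ) : x * y ∈ suppIn R (k + l) μ := by
  intro e he
  obtain ⟨v, w, hv, hw, rfl⟩ := exists_of_coeff_mul_ne_zero he
  rw [toReal_add]
  exact h.add_mem hk (hx v hv) (hy w hw)

theorem Absorbing.mul_pow_mem_suppIn (h : Absorbing Δ μ) {k l : ℕ} (hk : 1 ≤ k) {x y : Laurent R n}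
    (hx : x ∈ suppIn R k μ) (hy : y ∈ suppIn R l Δ) (j : ℕ) :
    x * y ^ j ∈ suppIn R (k + j * l) μ := by
  induction j with
  | zero => simpa using hx
  | succ j ih =>
    rw [pow_succ, ← mul_assoc, Nat.succ_mul, ← add_assoc]
    exact h.mul_mem_suppIn (by omega) ih hy

theorem absorbing_self (hΔ : Convex ℝ Δ) : Absorbing Δ Δ :=
  ⟨subset_rfl, fun _ hx _ hy _ _ hs ht hst => hΔ hx hy hs.le ht hst⟩

theorem pow_mem_suppIn (hΔ : Convex ℝ Δ) {f : Laurent R n} (hf : f ∈ suppIn R 1 Δ) {k : ℕ}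
    (hk : 1 ≤ k) : f ^ k ∈ suppIn R k Δ := by
  obtain ⟨j, rfl⟩ : ∃ j, k = j + 1 := ⟨k - 1, by omega⟩
  have := (absorbing_self hΔ).mul_pow_mem_suppIn le_rfl hf hf j
  rwa [mul_one, ← pow_succ', add_comm 1 j] at this

end Supports

/-! ### The substitution x ↦ x^p, the Cartier operator and Frobenius lifts. -/

section Frobenius

variable {R : Type*} [CommRing R] {n : ℕ} (p : ℕ)

theorem nsmul_injective_of_prime [hp : Fact p.Prime] :
    Function.Injective fun k : Fin n → ℤ => p • k := by
  intro x y h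
  funext i
  have := congrFun h i
  simpa [hp.out.ne_zero] using this

/-- The Cartier operator on Laurent polynomials. -/
def cartierPoly [Fact p.Prime] (g : Laurent R n) : Laurent R n :=
  AddMonoidAlgebra.comapDomain (fun k : Fin n → ℤ => p • k) (nsmul_injective_of_prime p) g

/-- The substitution `x ↦ x ^ p`. -/
def expand : Laurent R n →+* Laurent R n :=
  AddMonoidAlgebra.mapDomainRingHom R (nsmulAddMonoidHom p : (Fin n → ℤ) →+ (Fin n → ℤ))

theorem expand_single (w : Fin n → ℤ) (c : R) :
    expand p (AddMonoidAlgebra.single w c) = AddMonoidAlgebra.single (p • w) c := by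
  simp [expand]

theorem cartier_apply (ω : Formal R n) (e : Fin n → ℤ) : cartier R n p ω e = ω (p • e) := rfl

theorem cartier_act_expand (g : Laurent R n) (ω : Formal R n) :
    cartier R n p (act (expand p g) ω) = act g (cartier R n p ω) := by
  induction g using AddMonoidAlgebra.induction_linear with
  | zero => simp
  | add x y hx hy => simp [hx, hy]
  | single w c =>
    funext e
    rw [expand_single, cartier_apply, act_single, act_single, cartier_apply, smul_sub]

theorem cartier_mem_multiples {c : R} {ω : Formal R n} (h : ω ∈ multiples n c) :
    cartier R n p ω ∈ multiples n c := fun e => h (p • e)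

theorem exists_support_expand {f : Laurent R n} {e : Fin n → ℤ} (he : (expand p f).coeff e ≠ 0) :
    ∃ w, f.coeff w ≠ 0 ∧ e = p • w := by
  classical
  have : e ∈ (Finsupp.mapDomain (fun k : Fin n → ℤ => p • k) f.coeff).support :=
    Finsupp.mem_support_iff.2 he
  obtain ⟨w, hw, rfl⟩ := Finset.mem_image.1 (Finsupp.mapDomain_support this)
  exact ⟨w, by simpa using hw, rfl⟩

theorem expand_mem_suppIn {k : ℕ} {μ : Set (Fin n → ℝ)} {g : Laurent R n}
    (hg : g ∈ suppIn R k μ) : expand p g ∈ suppIn R (p * k) μ := by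
  intro u hu
  obtain ⟨w, hw, rfl⟩ := exists_support_expand p hu
  obtain ⟨x, hx, hxu⟩ := hg w hw
  refine ⟨x, hx, ?_⟩
  dsimp only at hxu ⊢
  rw [toReal_nsmul, ← hxu, smul_smul]
  push_cast
  rfl

section

variable {p} [hp : Fact p.Prime]

theorem coeff_cartierPoly (g : Laurent R n) (e : Fin n → ℤ) :
    (cartierPoly p g).coeff e = g.coeff (p • e) := rfl

theorem cartier_coeff (g : Laurent R n) :
    cartier R n p (g.coeff : Formal R n) = (cartierPoly p g).coeff := rfl

theorem cartierPoly_mem_suppIn {k : ℕ} {μ : Set (Fin n → ℝ)} {g : Laurent R n}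
    (hg : g ∈ suppIn R (p * k) μ) : cartierPoly p g ∈ suppIn R k μ := by
  intro u hu
  obtain ⟨x, hx, hxu⟩ := hg (p • u) hu
  refine ⟨x, hx, ?_⟩
  have hp0 : (p : ℝ) ≠ 0 := by exact_mod_cast hp.out.ne_zero
  refine smul_right_injective _ hp0 ?_
  dsimp only at hxu ⊢
  rw [← toReal_nsmul, ← hxu, smul_smul]
  push_cast
  rfl

theorem coeff_twist (σ : R →+* R) (f : Laurent R n) (e : Fin n → ℤ) :
    (twist σ f).coeff e = σ (f.coeff e) := by
  simp [twist]

theorem twist_mem_suppIn (σ : R →+* R) {k : ℕ} {μ : Set (Fin n → ℝ)} {f : Laurent R n}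
    (hf : f ∈ suppIn R k μ) : twist σ f ∈ suppIn R k μ := fun u hu =>
  hf u fun h => hu (by rw [coeff_twist, h, map_zero])

theorem IsVertex.map_twist {ℓ : (Fin n → ℤ) →+ ℝ} {b : Fin n → ℤ} {f : Laurent R n}
    (hf : IsVertex ℓ b f) (σ : R →+* R) : IsVertex ℓ b (twist σ f) := by
  refine ⟨by rw [coeff_twist]; exact hf.isUnit.map σ, fun w hw hwb => hf.lt w ?_ hwb⟩
  rw [Finsupp.mem_support_iff, coeff_twist] at hw
  rw [Finsupp.mem_support_iff]
  exact fun h => hw (by rw [h, map_zero])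

theorem exists_pow_eq_expand_twist_add {σ : R →+* R} (hσ : IsFrobeniusLift p σ)
    (f : Laurent R n) : ∃ G : Laurent R n, f ^ p = expand p (twist σ f) + (p : Laurent R n) * G := by
  induction f using AddMonoidAlgebra.induction_linear with
  | zero => exact ⟨0, by simp [twist, hp.out.ne_zero]⟩
  | add x y hx hy =>
    obtain ⟨G, hG⟩ := hx
    obtain ⟨H, hH⟩ := hy
    obtain ⟨r, hr⟩ := exists_add_pow_prime_eq hp.out x y
    refine ⟨G + H + x * y * r, ?_⟩
    rw [hr, hG, hH, show twist σ (x + y) = twist σ x + twist σ y from map_add _ _ _, map_add]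
    ring
  | single w c =>
    obtain ⟨d, hd⟩ := hσ c
    refine ⟨AddMonoidAlgebra.single (p • w) (-d), ?_⟩
    rw [AddMonoidAlgebra.single_pow, twist, AddMonoidAlgebra.mapRingHom_single, expand_single,
      ← nsmul_eq_mul, AddMonoidAlgebra.smul_single, ← AddMonoidAlgebra.single_add]
    congr 1
    rw [nsmul_eq_mul, mul_neg, ← hd]
    ring

/-- The support of G is controlled because pG is a difference of two polynomials supported in pΔ and
p is a nonzero element of a domain. -/
theorem exists_pow_eq_expand_twist_add_suppIn [IsDomain R] [CharZero R] {σ : R →+* R}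
    (hσ : IsFrobeniusLift p σ) {Δ : Set (Fin n → ℝ)} (hΔ : Convex ℝ Δ) {f : Laurent R n}
    (hf : f ∈ suppIn R 1 Δ) :
    ∃ G ∈ suppIn R p Δ, f ^ p = expand p (twist σ f) + (p : R) • G := by
  obtain ⟨G, hG⟩ := exists_pow_eq_expand_twist_add hσ f
  have hG' : f ^ p = expand p (twist σ f) + (p : R) • G := by
    rw [hG, Nat.cast_smul_eq_nsmul, nsmul_eq_mul]
  refine ⟨G, fun u hu => ?_, hG'⟩
  have h1 : (p : R) • G ∈ suppIn R p Δ := by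
    rw [← sub_eq_iff_eq_add'.2 hG']
    refine sub_mem (pow_mem_suppIn hΔ hf hp.out.one_lt.le) ?_
    simpa using expand_mem_suppIn (p := p) (twist_mem_suppIn σ hf)
  refine h1 u ?_
  rw [AddMonoidAlgebra.coeff_smul_apply, smul_eq_mul]
  exact mul_ne_zero (by exact_mod_cast hp.out.ne_zero) hu

end

end Frobenius

/-! ### Divisibility of factorials and of p^r/r!. -/

section DividedPowers

variable {R : Type*} [CommRing R] (p : ℕ)

theorem factorial_mul_pow_dvd (p J : ℕ) (hp : 0 < p) : J.factorial * p ^ J ∣ (p * J).factorial := by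
  induction J with
  | zero => simp
  | succ J ih =>
    obtain ⟨q, rfl⟩ : ∃ q, p = q + 1 := ⟨p - 1, by omega⟩
    rw [show (q + 1) * (J + 1) = ((q + 1) * J + q) + 1 by ring, Nat.factorial_succ, Nat.factorial_succ,
      show (J + 1) * J.factorial * (q + 1) ^ (J + 1) =
        ((q + 1) * J + q + 1) * (J.factorial * (q + 1) ^ J) by ring]
    exact mul_dvd_mul_left _ (ih.trans (Nat.factorial_dvd_factorial (by omega)))

/-- This is why sums ∑ j! g_j/f^(j+1) are truncated at j < pN when working modulo p^N. -/
theorem pow_dvd_factorial_mul (p N : ℕ) (hp : 0 < p) : p ^ N ∣ (p * N).factorial :=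
  (Dvd.intro_left _ rfl).trans (factorial_mul_pow_dvd p N hp)

theorem isUnit_natCast_of_coprime [IsAdicComplete (Ideal.span {(p : R)}) R] {m : ℕ}
    (hm : m.Coprime p) : IsUnit (m : R) := by
  have hj : (p : R) ∈ Ideal.jacobson (⊥ : Ideal R) :=
    IsAdicComplete.le_jacobson_bot (Ideal.span {(p : R)}) (Ideal.mem_span_singleton_self _)
  have hb := Nat.gcd_eq_gcd_ab m p
  rw [hm] at hb
  have hb' : (1 : R) = m * (m.gcdA p : ℤ) + p * (m.gcdB p : ℤ) := by exact_mod_cast congrArg (Int.cast (R := R)) hb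
  have hu := Ideal.mem_jacobson_bot.1 hj (-(m.gcdB p : ℤ))
  rw [show (p : R) * -(m.gcdB p : ℤ) + 1 = m * (m.gcdA p : ℤ) by rw [hb']; ring] at hu
  exact isUnit_of_mul_isUnit_left hu

/-- Times p^r, this reads J! · binom(-(J+1), r) · p^r = ±(J+r)! · p^r/r!: the factorial attached to
the new pole order J + r + 1 appears, with only the divided power p^r/r! left over. -/
theorem factorial_mul_choose_neg (J r : ℕ) :
    (J.factorial : ℤ) * r.factorial * Ring.choose (-((J + 1 : ℕ) : ℤ)) r =
      (-1) ^ r * (J + r).factorial := by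
  rw [Ring.choose_neg, show ((J + 1 : ℕ) : ℤ) + r - 1 = ((J + r : ℕ) : ℤ) by push_cast; ring,
    Ring.choose_natCast, ← Nat.add_choose_mul_factorial_mul_factorial J r]
  have h : ((Int.negOnePow (r : ℤ) : ℤˣ) : ℤ) = (-1) ^ r := by
    simp [Int.negOnePow_def]
  rw [Units.smul_def, h, smul_eq_mul]
  push_cast
  ring

variable [hp : Fact p.Prime]

/-- Here c = p^r/r!, integral since integers prime to p are units. For r ≥ 1, Legendre's bound (p-1)
ord_p(r!) < r gives at least one factor p, and for p ≥ 3 at least r/2 + 1 of them. The growing bound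
is what separates odd p from p = 2. -/
theorem exists_factorial_mul_eq_pow [IsAdicComplete (Ideal.span {(p : R)}) R] (r : ℕ) :
    ∃ c : R, (r.factorial : R) * c = (p : R) ^ r ∧ (1 ≤ r → (p : R) ∣ c) ∧
      (p ≠ 2 → 1 ≤ r → (p : R) ^ (r / 2 + 1) ∣ c) := by
  set v := padicValNat p r.factorial with hv
  obtain ⟨m, hm⟩ : p ^ v ∣ r.factorial := pow_padicValNat_dvd
  have hcop : m.Coprime p := by
    refine Nat.Coprime.symm ((Nat.Prime.coprime_iff_not_dvd hp.out).2 fun ⟨k, hk⟩ => ?_)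
    refine pow_succ_padicValNat_not_dvd (p := p) r.factorial_ne_zero ⟨k, ?_⟩
    rw [← hv, hm, hk]
    simp [pow_succ, mul_assoc]
  obtain ⟨u, hu⟩ := isUnit_natCast_of_coprime (R := R) p hcop
  have hdig : 1 ≤ r → (p - 1) * v + 1 ≤ r := fun hr =>
    sub_one_mul_padicValNat_factorial_lt_of_ne_zero p (by omega)
  have hp2 := hp.out.two_le
  have hv1 : 1 ≤ r → v + 1 ≤ r := fun hr => by
    have := hdig hr
    have : 1 * v ≤ (p - 1) * v := Nat.mul_le_mul_right _ (by omega)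
    omega
  have hvr : v ≤ r := by
    rcases Nat.eq_zero_or_pos r with rfl | hr
    · simp [hv]
    · exact (Nat.le_succ v).trans (hv1 hr)
  refine ⟨(↑u⁻¹ : R) * (p : R) ^ (r - v), ?_, fun hr => ?_, fun hp' hr => ?_⟩
  · rw [hm]
    push_cast
    rw [← hu]
    calc _ = (p : R) ^ v * (p : R) ^ (r - v) * (u * ↑u⁻¹) := by ring
      _ = _ := by rw [u.mul_inv, mul_one, ← pow_add, Nat.add_sub_cancel' hvr]
  · exact (dvd_pow_self _ (by have := hv1 hr; omega)).mul_left _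
  · refine (pow_dvd_pow _ ?_).mul_left _
    have := hdig hr
    have : 2 * v ≤ (p - 1) * v := Nat.mul_le_mul_right _ (by omega)
    omega

end DividedPowers

/-! ### The Cartier operator on a single fraction with denominator f^(pk). -/

section CartierExpansion

variable {R : Type*} [CommRing R] {n : ℕ} {p : ℕ} [hp : Fact p.Prime]
  {ℓ : (Fin n → ℤ) →+ ℝ} {b : Fin n → ℤ} {f F G : Laurent R n}

theorem cartier_mem_boundedBelow {ω : Formal R n} (h : ω ∈ boundedBelow R ℓ) :
    cartier R n p ω ∈ boundedBelow R ℓ := by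
  obtain ⟨c, hc⟩ := h
  have hp0 : (0 : ℝ) < p := by exact_mod_cast hp.out.pos
  refine ⟨c / p, fun e he => ?_⟩
  have := hc _ he
  rw [map_nsmul, nsmul_eq_mul] at this
  rwa [div_le_iff₀' hp0]

/-- Multiplication by F^(k+M) passes through C_p as multiplication by F(x^p)^(k+M); the truncated
binomial identity for F(x^p) + pG then leaves an error divisible by (pG)^M. -/
theorem cartier_expansion_sub_mem (hf : IsVertex ℓ b f) (hF : IsVertex ℓ b F)
    (hG : f ^ p = expand p F + (p : R) • G) (x : Laurent R n) (k M : ℕ) :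
    cartier R n p (expansion b f x (p * k)) - ∑ r ∈ Finset.range M,
      ((Ring.choose (-(k : ℤ)) r : ℤ) * (p : R) ^ r) •
        expansion b F (cartierPoly p (x * G ^ r)) (k + r) ∈ multiples n ((p : R) ^ M) := by
  set ω := expansion b f x (p * k) with hω
  obtain ⟨q, hq⟩ := exists_add_pow_mul_sum_choose_neg (expand p F) ((p : R) • G) k M
  have h1 : act ((expand p F + (p : R) • G) ^ k) ω = x.coeff := by
    rw [← hG, ← pow_mul, hω, hf.act_expansion]
  refine hF.mem_multiples_of_act_pow (k + M) (sub_mem (cartier_mem_boundedBelow (hf.expansion_mem _ _))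
    (sum_mem fun r _ => Submodule.smul_mem _ _ (hF.expansion_mem _ _))) ?_
  have h2 : act (F ^ (k + M)) (∑ r ∈ Finset.range M, ((Ring.choose (-(k : ℤ)) r : ℤ) * (p : R) ^ r) •
      expansion b F (cartierPoly p (x * G ^ r)) (k + r)) =
      cartier R n p (act (∑ r ∈ Finset.range M, ((Ring.choose (-(k : ℤ)) r : ℤ) : Laurent R n) *
        expand p F ^ (M - r) * ((p : R) • G) ^ r) x.coeff) := by
    rw [map_sum, map_sum, LinearMap.sum_apply, map_sum]
    refine Finset.sum_congr rfl fun r hr => ?_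
    have hr' : r ≤ M := (Finset.mem_range.1 hr).le
    have h3 : ((Ring.choose (-(k : ℤ)) r : ℤ) : Laurent R n) * expand p F ^ (M - r) * ((p : R) • G) ^ r =
        ((Ring.choose (-(k : ℤ)) r : ℤ) * (p : R) ^ r) • (expand p (F ^ (M - r)) * G ^ r) := by
      rw [smul_pow, mul_smul_comm, mul_comm _ ((p : R) ^ r), mul_smul, map_pow, mul_assoc,
        ← zsmul_eq_mul, Int.cast_smul_eq_zsmul]
    rw [h3, map_smul, map_smul, LinearMap.smul_apply, map_smul,
      show k + M = (M - r) + (k + r) by omega, pow_add, act_mul, hF.act_expansion, act_coeff, act_mul,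
      cartier_act_expand, act_coeff, cartier_coeff, act_coeff, mul_comm x]
  rw [map_sub, h2, ← h1, ← act_mul, mul_comm, hq, map_add, LinearMap.add_apply, map_add, ← map_pow,
    cartier_act_expand, sub_add_cancel_left, smul_pow, smul_mul_assoc, map_smul, LinearMap.smul_apply, map_smul]
  exact neg_mem (smul_mem_multiples _ _)

end CartierExpansion

/-! ### The Cartier operator on series ∑ j! g_j/f^(j+1). -/

section CartierNumerators

variable {R : Type*} [CommRing R] {n : ℕ} {p : ℕ} [hp : Fact p.Prime]
  {ℓ : (Fin n → ℤ) →+ ℝ} {b : Fin n → ℤ} {f F G : Laurent R n} {Δ μ : Set (Fin n → ℝ)}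

theorem IsVertex.expansion_sum (hf : IsVertex ℓ b f) {ι : Type*} (s : Finset ι)
    (g : ι → Laurent R n) (k : ℕ) :
    expansion b f (∑ i ∈ s, g i) k = ∑ i ∈ s, expansion b f (g i) k :=
  map_sum (hf.expansionHom k) g s

/-- The series `ω` is the sum `∑ j! g_j / f ^ (j + 1)`, with `g_j` supported in `(j + 1) μ`. -/
structure IsExpansionSum (p : ℕ) (b : Fin n → ℤ) (μ : Set (Fin n → ℝ)) (f : Laurent R n)
    (g : ℕ → Laurent R n) (ω : Formal R n) : Prop where
  supp : ∀ j, g j ∈ suppIn R (j + 1) μ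
  sub_mem : ∀ N, ω - ∑ j ∈ Finset.range (p * N), (j.factorial : R) • expansion b f (g j) (j + 1) ∈
    multiples n ((p : R) ^ N)

/-- Each run of p consecutive pole orders is brought to the denominator f^(p(J+1)), the form C_p can
handle. The factor p^J J! comes out since it divides every (pJ+i)!. -/
theorem IsVertex.exists_block (hf : IsVertex ℓ b f) (hfs : f ∈ suppIn R 1 Δ) (hμ : Absorbing Δ μ)
    {g : ℕ → Laurent R n} (hg : ∀ j, g j ∈ suppIn R (j + 1) μ) :
    ∃ x : ℕ → Laurent R n, (∀ J, x J ∈ suppIn R (p * (J + 1)) μ) ∧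
      x 0 = ∑ i ∈ Finset.range p, (i.factorial : R) • (f ^ (p - 1 - i) * g i) ∧
      ∀ N, ∑ j ∈ Finset.range (p * N), (j.factorial : R) • expansion b f (g j) (j + 1) =
        ∑ J ∈ Finset.range N, ((p : R) ^ J * J.factorial) • expansion b f (x J) (p * (J + 1)) := by
  have ha : ∀ J i, ∃ a : ℕ, (p * J + i).factorial = J.factorial * p ^ J * a := fun J i =>
    (factorial_mul_pow_dvd p J hp.out.pos).trans (Nat.factorial_dvd_factorial (Nat.le_add_right _ _))
  choose a ha using ha
  refine ⟨fun J => ∑ i ∈ Finset.range p, (a J i : R) • (f ^ (p - 1 - i) * g (p * J + i)),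
    fun J => ?_, ?_, fun N => ?_⟩
  · refine sum_mem fun i hi => Submodule.smul_mem _ _ ?_
    have hi' := Finset.mem_range.1 hi
    have := hμ.mul_pow_mem_suppIn (by omega) (hg (p * J + i)) hfs (p - 1 - i)
    rw [mul_one, show p * J + i + 1 + (p - 1 - i) = p * (J + 1) by rw [mul_add]; omega] at this
    rwa [mul_comm (f ^ _)]
  · refine Finset.sum_congr rfl fun i _ => ?_
    have := ha 0 i
    simp only [mul_zero, zero_add, Nat.factorial_zero, pow_zero, mul_one, one_mul] at this
    rw [← this, mul_zero, zero_add]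
  · induction N with
    | zero => simp
    | succ N ih =>
      rw [mul_add, mul_one, Finset.sum_range_add, ih, Finset.sum_range_succ _ N]
      congr 1
      rw [hf.expansion_sum, Finset.smul_sum]
      refine Finset.sum_congr rfl fun i hi => ?_
      have hi' := Finset.mem_range.1 hi
      rw [hf.expansion_smul, smul_smul, ← hf.expansion_pow_mul (g (p * N + i)) (p - 1 - i), ha N i,
        show p - 1 - i + (p * N + i + 1) = p * (N + 1) by rw [mul_add]; omega]
      push_cast
      congr 1
      ring

/-- Block J expanded to order r contributes to pole order J + r + 1 with coefficient ±(J+r)! p^J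
c_r. The power ε of p extracted from p^J c_r is left open, as the bound available depends on whether
p is odd. -/
theorem IsExpansionSum.exists_cartier [IsDomain R] [CharZero R]
    (hf : IsVertex ℓ b f) (hF : IsVertex ℓ b F) (hfs : f ∈ suppIn R 1 Δ) (hμ : Absorbing Δ μ)
    (hG : f ^ p = expand p F + (p : R) • G) (hGs : G ∈ suppIn R p Δ)
    {c : ℕ → R} (hc : ∀ r, (r.factorial : R) * c r = (p : R) ^ r)
    {ε : ℕ → ℕ} {d : ℕ → ℕ → R} (hd : ∀ J r, (p : R) ^ J * c r = (p : R) ^ ε (J + r) * d J r)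
    (hd0 : d 0 0 = 1) {g : ℕ → Laurent R n} {ω : Formal R n} (h : IsExpansionSum p b μ f g ω) :
    ∃ y : ℕ → Laurent R n, (∀ l, y l ∈ suppIn R (l + 1) μ) ∧
      y 0 = cartierPoly p (∑ i ∈ Finset.range p, (i.factorial : R) • (f ^ (p - 1 - i) * g i)) ∧
      ∀ N, cartier R n p ω - ∑ l ∈ Finset.range N,
        ((l.factorial : R) * (p : R) ^ ε l) • expansion b F (y l) (l + 1) ∈
          multiples n ((p : R) ^ N) := by
  obtain ⟨x, hx, hx0, hxs⟩ := hf.exists_block (p := p) hfs hμ h.supp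
  refine ⟨fun l => ∑ k ∈ Finset.range (l + 1),
    ((-1) ^ (l - k) * d k (l - k)) • cartierPoly p (x k * G ^ (l - k)), fun l => ?_, ?_, fun N => ?_⟩
  · refine sum_mem fun k hk => Submodule.smul_mem _ _ (cartierPoly_mem_suppIn ?_)
    have hk' := Finset.mem_range.1 hk
    have := hμ.mul_pow_mem_suppIn (Nat.mul_pos hp.out.pos (Nat.succ_pos k)) (hx k) hGs (l - k)
    rwa [mul_comm (l - k), ← mul_add, show k + 1 + (l - k) = l + 1 by omega] at this
  · simp [hd0, hx0]
  · have hcoef : ∀ J r, (p : R) ^ J * J.factorial * ((Ring.choose (-((J + 1 : ℕ) : ℤ)) r : ℤ) * (p : R) ^ r) =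
        (J + r).factorial * (p : R) ^ ε (J + r) * ((-1) ^ r * d J r) := by
      intro J r
      refine mul_left_cancel₀ (Nat.cast_ne_zero.2 r.factorial_ne_zero : (r.factorial : R) ≠ 0) ?_
      have h1 := congrArg (Int.cast (R := R)) (factorial_mul_choose_neg J r)
      push_cast at h1 ⊢
      calc _ = ((J.factorial : R) * r.factorial * (Ring.choose (-((J : ℤ) + 1)) r : ℤ)) *
            ((p : R) ^ J * (p : R) ^ r) := by ring
        _ = ((-1) ^ r * (J + r).factorial) * ((p : R) ^ J * (r.factorial * c r)) := by rw [h1, hc]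
        _ = ((-1) ^ r * (J + r).factorial) * (r.factorial * ((p : R) ^ J * c r)) := by ring
        _ = _ := by rw [hd]; ring
    -- Resummation of the triangle J + r < N along the diagonals l = J + r. Block J needs only r < N
    -- - J, as it already carries p^J.
    have hflip : ∑ l ∈ Finset.range N, ((l.factorial : R) * (p : R) ^ ε l) •
        expansion b F (∑ k ∈ Finset.range (l + 1),
          ((-1) ^ (l - k) * d k (l - k)) • cartierPoly p (x k * G ^ (l - k))) (l + 1) =
        ∑ J ∈ Finset.range N, ((p : R) ^ J * J.factorial) • ∑ r ∈ Finset.range (N - J),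
          ((Ring.choose (-((J + 1 : ℕ) : ℤ)) r : ℤ) * (p : R) ^ r) •
            expansion b F (cartierPoly p (x J * G ^ r)) (J + 1 + r) := by
      simp_rw [Finset.smul_sum, smul_smul, hcoef]
      rw [← Finset.sum_range_diag_flip N fun J r => (((J + r).factorial : R) * (p : R) ^ ε (J + r) *
        ((-1) ^ r * d J r)) • expansion b F (cartierPoly p (x J * G ^ r)) (J + 1 + r)]
      refine Finset.sum_congr rfl fun l _ => ?_
      rw [hF.expansion_sum, Finset.smul_sum]
      refine Finset.sum_congr rfl fun k hk => ?_
      have hk' := Finset.mem_range.1 hk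
      rw [hF.expansion_smul, smul_smul, show k + (l - k) = l by omega,
        show k + 1 + (l - k) = l + 1 by omega]
    have h1 := cartier_mem_multiples p (h.sub_mem N)
    rw [hxs, map_sub, map_sum] at h1
    rw [hflip]
    rw [← sub_add_sub_cancel]
    refine add_mem h1 ?_
    rw [← Finset.sum_sub_distrib]
    refine sum_mem fun J hJ => ?_
    rw [map_smul, ← smul_sub, mul_comm, mul_smul]
    refine Submodule.smul_mem _ _ ?_
    have h2 := smul_mem_multiples_mul (c := (p : R) ^ J)
      (cartier_expansion_sub_mem hf hF hG (x J) (J + 1) (N - J))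
    rwa [← pow_add, Nat.add_sub_cancel' (Finset.mem_range.1 hJ).le] at h2

end CartierNumerators

/-! ### The completion of Ω_f and its comparison with series ∑ j! g_j/f^(j+1). -/

section Completion

variable {R : Type*} [CommRing R] {n : ℕ} {p : ℕ}

theorem mem_span_pow_smul_top {M : Type*} [AddCommGroup M] [Module R M] {N : ℕ} {x : M} :
    x ∈ (Ideal.span {(p : R)} ^ N • ⊤ : Submodule R M) ↔ ∃ y, x = (p : R) ^ N • y := by
  rw [Ideal.span_singleton_pow, Submodule.ideal_span_singleton_smul,
    Submodule.mem_smul_pointwise_iff_exists]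
  simp [eq_comm]

theorem exists_adic_sum [IsAdicComplete (Ideal.span {(p : R)}) R] (x : ℕ → R) :
    ∃ X : R, ∀ N, (p : R) ^ N ∣ X - ∑ j ∈ Finset.range N, (p : R) ^ j * x j := by
  have hstep : ∀ {m N : ℕ}, m ≤ N → (∑ j ∈ Finset.range m, (p : R) ^ j * x j) ≡
      (∑ j ∈ Finset.range N, (p : R) ^ j * x j) [SMOD (Ideal.span {(p : R)} ^ m • ⊤ : Submodule R R)] := by
    intro m N hmN
    rw [SModEq.sub_mem, mem_span_pow_smul_top, ← Finset.sum_range_add_sum_Ico _ hmN]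
    refine ⟨-∑ j ∈ Finset.Ico m N, (p : R) ^ (j - m) * x j, ?_⟩
    rw [sub_add_cancel_left, smul_neg, Finset.smul_sum]
    congr 1
    refine Finset.sum_congr rfl fun j hj => ?_
    rw [smul_eq_mul, ← mul_assoc, ← pow_add, Nat.add_sub_cancel' (Finset.mem_Ico.1 hj).1]
  obtain ⟨X, hX⟩ := IsPrecomplete.prec (I := Ideal.span {(p : R)}) (M := R) inferInstance hstep
  refine ⟨X, fun N => ?_⟩
  obtain ⟨y, hy⟩ := mem_span_pow_smul_top.1 (SModEq.sub_mem.1 (hX N).symm)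
  exact ⟨y, hy⟩

/-- The two conditions use different topologies: successive differences are divisible by p^N within
Ω_f itself, while the limit is taken coefficientwise modulo p^N. -/
theorem mem_completedOmega_iff {b : Fin n → ℤ} {μ : Set (Fin n → ℝ)} {f : Laurent R n}
    {ω : Formal R n} : ω ∈ completedOmega p b μ f ↔
      ∃ a : ℕ → Omega b μ f, (∀ N, ∃ d, a (N + 1) - a N = (p : R) ^ N • d) ∧
        ∀ N, ω - a N ∈ multiples n ((p : R) ^ N) := by
  have hval : ∀ (a : AdicCompletion.AdicCauchySequence (Ideal.span {(p : R)}) (Omega b μ f)),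
      AdicCompletion.map (Ideal.span {(p : R)}) (Omega b μ f).subtype
        (AdicCompletion.mk _ _ a) = AdicCompletion.of (Ideal.span {(p : R)}) (Formal R n) ω ↔
      ∀ N, ω - a N ∈ multiples n ((p : R) ^ N) := by
    intro a
    rw [AdicCompletion.map_mk, eq_comm, AdicCompletion.ext_iff]
    refine forall_congr' fun N => ?_
    rw [mem_multiples_iff_exists, ← mem_span_pow_smul_top]
    exact Submodule.Quotient.eq _
  rw [completedOmega, Submodule.mem_comap]
  constructor
  · rintro ⟨x, hx⟩
    obtain ⟨a, rfl⟩ := AdicCompletion.mk_surjective _ _ x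
    refine ⟨a, fun N => ?_, (hval a).1 hx⟩
    exact mem_span_pow_smul_top.1 (SModEq.sub_mem.1 (a.2 (Nat.le_succ N)).symm)
  · rintro ⟨a, ha, hω⟩
    refine ⟨AdicCompletion.mk _ _ (AdicCompletion.AdicCauchySequence.mk _ _ a fun N => ?_),
      (hval _).2 hω⟩
    exact (SModEq.sub_mem.2 (mem_span_pow_smul_top.2 (ha N))).symm

variable {ℓ : (Fin n → ℤ) →+ ℝ} {b : Fin n → ℤ} {f : Laurent R n} {μ : Set (Fin n → ℝ)}

theorem Omega_le_completedOmega : Omega b μ f ≤ completedOmega p b μ f := fun ω hω =>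
  mem_completedOmega_iff.2 ⟨fun _ => ⟨ω, hω⟩, fun _ => ⟨0, by simp⟩, fun N => by simp⟩

theorem factorial_smul_expansion_mem_Omega {g : Laurent R n} {j : ℕ} (hg : g ∈ suppIn R (j + 1) μ) :
    (j.factorial : R) • expansion b f g (j + 1) ∈ Omega b μ f :=
  Submodule.subset_span ⟨j + 1, g, by omega, fun u hu => hg u (by simpa using hu), rfl⟩

theorem IsVertex.exists_eq_sum_of_mem_Omega (hf : IsVertex ℓ b f) {ω : Formal R n}
    (hω : ω ∈ Omega b μ f) : ∃ g : ℕ → Laurent R n, (∀ j, g j ∈ suppIn R (j + 1) μ) ∧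
      ∃ m, ∀ M, m ≤ M →
        ω = ∑ j ∈ Finset.range M, (j.factorial : R) • expansion b f (g j) (j + 1) := by
  have hz : ∀ k, expansion b f 0 k = 0 := fun k => map_zero (hf.expansionHom k)
  induction hω using Submodule.span_induction with
  | mem x hx =>
    obtain ⟨k, g, hk, hg, rfl⟩ := hx
    refine ⟨Pi.single (k - 1) g, fun j => ?_, k, fun M hM => ?_⟩
    · rcases eq_or_ne j (k - 1) with rfl | hj
      · rw [Pi.single_eq_same, Nat.sub_add_cancel hk]
        exact fun u hu => hg u (by simpa using hu)
      · rw [Pi.single_eq_of_ne hj]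
        exact zero_mem _
    · rw [Finset.sum_eq_single_of_mem (k - 1) (Finset.mem_range.2 (by omega)) fun j _ hj => ?_]
      · rw [Pi.single_eq_same, Nat.sub_add_cancel hk]
      · rw [Pi.single_eq_of_ne hj, hz, smul_zero]
  | zero => exact ⟨0, fun j => zero_mem _, 0, fun M _ => by simp [hz]⟩
  | add x y _ _ hx hy =>
    obtain ⟨g, hg, m, hm⟩ := hx
    obtain ⟨h, hh, m', hm'⟩ := hy
    refine ⟨g + h, fun j => add_mem (hg j) (hh j), max m m', fun M hM => ?_⟩
    rw [hm M (by omega), hm' M (by omega), ← Finset.sum_add_distrib]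
    exact Finset.sum_congr rfl fun j _ => by rw [Pi.add_apply, hf.expansion_add, smul_add]
  | smul c x _ hx =>
    obtain ⟨g, hg, m, hm⟩ := hx
    refine ⟨c • g, fun j => Submodule.smul_mem _ c (hg j), m, fun M hM => ?_⟩
    rw [hm M hM, Finset.smul_sum]
    exact Finset.sum_congr rfl fun j _ => by
      rw [Pi.smul_apply, hf.expansion_smul, smul_comm]

/-- The formal series of the form `∑ j! g_j / f ^ (j + 1)` with `g_j` supported in `(j + 1) μ`. -/
def IsVertex.expansionSums (hf : IsVertex ℓ b f) (p : ℕ) (μ : Set (Fin n → ℝ)) :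
    Submodule R (Formal R n) where
  carrier := {ω | ∃ g, IsExpansionSum p b μ f g ω}
  add_mem' := by
    rintro x y ⟨g, hg⟩ ⟨h, hh⟩
    refine ⟨g + h, fun j => add_mem (hg.supp j) (hh.supp j), fun N => ?_⟩
    convert add_mem (hg.sub_mem N) (hh.sub_mem N) using 1
    simp_rw [Pi.add_apply, hf.expansion_add, smul_add, Finset.sum_add_distrib]
    abel
  zero_mem' := ⟨0, fun j => zero_mem _, fun N => by
    simp [show ∀ k, expansion b f 0 k = 0 from fun k => map_zero (hf.expansionHom k)]⟩
  smul_mem' := by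
    rintro c x ⟨g, hg⟩
    refine ⟨c • g, fun j => Submodule.smul_mem _ c (hg.supp j), fun N => ?_⟩
    convert Submodule.smul_mem _ c (hg.sub_mem N) using 1
    rw [smul_sub, Finset.smul_sum]
    congr 1
    exact Finset.sum_congr rfl fun j _ => by rw [Pi.smul_apply, hf.expansion_smul, smul_comm]

theorem exists_adic_sum_suppIn [IsAdicComplete (Ideal.span {(p : R)}) R] {k : ℕ}
    (hμ : {u : Fin n → ℤ | toReal u ∈ (k : ℝ) • μ}.Finite) {x : ℕ → Laurent R n}
    (hx : ∀ j, x j ∈ suppIn R k μ) : ∃ X ∈ suppIn R k μ, ∀ N e,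
      (p : R) ^ N ∣ (X - ∑ j ∈ Finset.range N, (p : R) ^ j • x j).coeff e := by
  classical
  choose X hX using fun e => exists_adic_sum (p := p) fun j => (x j).coeff e
  set Y : Laurent R n := AddMonoidAlgebra.ofCoeff (Finsupp.onFinset hμ.toFinset
    (fun e => if toReal e ∈ (k : ℝ) • μ then X e else 0)
    (fun e he => by
      by_contra h
      exact he (if_neg (by simpa using h)))) with hY
  have hYe : ∀ e, Y.coeff e = if toReal e ∈ (k : ℝ) • μ then X e else 0 := fun e => rfl
  refine ⟨Y, fun e he => ?_, fun N e => ?_⟩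
  · by_contra h
    exact he (by rw [hYe, if_neg h])
  · rw [AddMonoidAlgebra.coeff_sub, AddMonoidAlgebra.coeff_sum, Finsupp.sub_apply,
      Finsupp.finsetSum_apply, hYe]
    split_ifs with h
    · exact hX e N
    · rw [Finset.sum_eq_zero fun j _ => ?_]
      · simp
      · rw [AddMonoidAlgebra.coeff_smul_apply, not_not.1 fun h0 => h (hx j e h0), smul_zero]

/-- Write ω = ∑ p^j d_j with d_j in Ω_f and add up the numerators of each pole order separately;
each such p-adic sum is again a Laurent polynomial because the dilates of μ have finitely many
integral points. -/
theorem IsVertex.completedOmega_le (hf : IsVertex ℓ b f) [hp : Fact p.Prime]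
    [IsAdicComplete (Ideal.span {(p : R)}) R]
    (hμ : ∀ k : ℕ, {u : Fin n → ℤ | toReal u ∈ (k : ℝ) • μ}.Finite) :
    completedOmega p b μ f ≤ hf.expansionSums p μ := by
  intro ω hω
  obtain ⟨a, ha, haω⟩ := mem_completedOmega_iff.1 hω
  choose d hd using ha
  obtain ⟨d', hd'⟩ : ∃ d' : ℕ → Omega b μ f, ∀ N,
      ω - ∑ j ∈ Finset.range N, (p : R) ^ j • (d' j : Formal R n) ∈ multiples n ((p : R) ^ N) := by
    -- The difference a 1 - a 0 carries p^0, so the starting term a 0 is absorbed into index 0.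
    refine ⟨Function.update d 0 (a 0 + d 0), fun N => ?_⟩
    rcases N with _ | N
    · simpa using smul_mem_multiples (1 : R) ω
    have h : ∑ j ∈ Finset.range (N + 1),
        (p : R) ^ j • ((Function.update d 0 (a 0 + d 0) j : Omega b μ f) : Formal R n) = a (N + 1) := by
      induction N with
      | zero =>
        have := hd 0
        rw [sub_eq_iff_eq_add, pow_zero, one_smul] at this
        simp [this, add_comm]
      | succ N ih =>
        have := hd (N + 1)
        rw [sub_eq_iff_eq_add] at this
        rw [Finset.sum_range_succ, ih, this, Function.update_of_ne (by omega)]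
        simp [add_comm]
    rw [h]
    exact haω _
  choose g hg m hm using fun j => hf.exists_eq_sum_of_mem_Omega (d' j).2
  choose X hX hXs using fun k => exists_adic_sum_suppIn (p := p) (hμ (k + 1)) fun j => hg j k
  refine ⟨X, hX, fun N => ?_⟩
  rw [← sub_add_sub_cancel]
  refine add_mem (hd' N) ?_
  -- M bounds the lengths of d'_0, …, d'_(N-1) at once; the excess terms with index k ≥ pN vanish
  -- modulo p^N because of k!.
  set M := p * N + ∑ j ∈ Finset.range N, m j with hM
  have h1 : ∑ j ∈ Finset.range N, (p : R) ^ j • (d' j : Formal R n) =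
      ∑ k ∈ Finset.range M, (k.factorial : R) •
        expansion b f (∑ j ∈ Finset.range N, (p : R) ^ j • g j k) (k + 1) := by
    simp_rw [hf.expansion_sum, hf.expansion_smul, Finset.smul_sum]
    rw [Finset.sum_comm]
    refine Finset.sum_congr rfl fun j hj => ?_
    rw [hm j M ((Finset.single_le_sum (f := m) (fun _ _ => Nat.zero_le _) hj).trans
      (Nat.le_add_left _ _)), Finset.smul_sum]
    exact Finset.sum_congr rfl fun k _ => smul_comm _ _ _
  rw [h1, hM, Finset.sum_range_add, add_sub_right_comm]
  refine add_mem ?_ (sum_mem fun k _ => ?_)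
  · rw [← Finset.sum_sub_distrib]
    refine sum_mem fun k _ => ?_
    rw [← smul_sub, ← neg_sub, smul_neg]
    refine neg_mem (Submodule.smul_mem _ _ ?_)
    have := hf.expansion_mem_multiples (hXs k N) (k + 1)
    rwa [show expansion b f (X k - ∑ j ∈ Finset.range N, (p : R) ^ j • g j k) (k + 1) = _ from
      map_sub (hf.expansionHom (k + 1)) _ _] at this
  · refine multiples_anti ?_ (smul_mem_multiples _ _)
    exact_mod_cast Nat.cast_dvd_cast (α := R) ((pow_dvd_factorial_mul p N hp.out.pos).trans
      (Nat.factorial_dvd_factorial (Nat.le_add_right _ _)))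

end Completion

/-! ### Unit root decomposition in abstract form. -/

section UnitRoot

open Matrix

variable {R : Type*} [CommRing R] {p : ℕ} {ι V : Type*} [Fintype ι]
  [AddCommGroup V] [Module R V] (C : Module.End R V) (e : ℕ → ι → V) (B : ℕ → Matrix ι ι R)

theorem eq_zero_of_forall_pow_dvd [IsAdicComplete (Ideal.span {(p : R)}) R] {x : R}
    (h : ∀ k : ℕ, (p : R) ^ k ∣ x) : x = 0 := by
  refine IsHausdorff.haus (I := Ideal.span {(p : R)}) inferInstance x fun k => ?_
  rw [SModEq.zero, mem_span_pow_smul_top]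
  exact h k

theorem apply_sum_smul {M : ℕ → Submodule R V}
    (hCe : ∀ i u, ∃ η ∈ M (i + 1), C (e i u) = ∑ v, B i u v • e (i + 1) v + (p : R) • η)
    (i : ℕ) (a : ι → R) : ∃ η ∈ M (i + 1),
      C (∑ u, a u • e i u) = ∑ v, (a ᵥ* B i) v • e (i + 1) v + (p : R) • η := by
  choose η hη hCη using hCe i
  refine ⟨∑ u, a u • η u, sum_mem fun u _ => Submodule.smul_mem _ _ (hη u), ?_⟩
  rw [map_sum]
  simp_rw [map_smul, hCη, smul_add, Finset.sum_add_distrib, Finset.smul_sum, vecMul, dotProduct,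
    Finset.sum_smul, smul_smul]
  rw [Finset.sum_comm]
  congr 1
  exact Finset.sum_congr rfl fun u _ => by rw [mul_comm]

/-- The unit root decomposition: if `C` acts invertibly modulo `p` on the
span of the `e i u`, and maps everything into this span modulo `p`, then every element is the sum
of an element of this span and an element on which `C ^ s` is divisible by `p ^ s`. -/
theorem exists_unitRoot_decomposition [DecidableEq ι] [IsAdicComplete (Ideal.span {(p : R)}) R]
    {M : ℕ → Submodule R V} (hB : ∀ i, IsUnit (B i)) (he : ∀ i u, e i u ∈ M i)
    (hC : ∀ i, ∀ ω ∈ M i, ∃ a : ι → R, ∃ η ∈ M (i + 1),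
      C ω = ∑ v, a v • e (i + 1) v + (p : R) • η)
    (hCe : ∀ i u, ∃ η ∈ M (i + 1), C (e i u) = ∑ v, B i u v • e (i + 1) v + (p : R) • η)
    {ω : V} (hω : ω ∈ M 0) :
    ∃ a : ι → R, ∀ s, ∃ η ∈ M s, (C ^ s) (ω - ∑ u, a u • e 0 u) = (p : R) ^ s • η := by
  have hlc : ∀ i (a : ι → R), ∑ u, a u • e i u ∈ M i := fun i a =>
    sum_mem fun u _ => Submodule.smul_mem _ _ (he i u)
  have hCM : ∀ i, ∀ ω ∈ M i, C ω ∈ M (i + 1) := by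
    intro i ω hω
    obtain ⟨a, η, hη, h⟩ := hC i ω hω
    rw [h]
    exact add_mem (hlc _ a) (Submodule.smul_mem _ _ hη)
  have hiter : ∀ s, ∀ ω ∈ M 0, (C ^ s) ω ∈ M s := by
    intro s ω hω
    induction s with
    | zero => simpa using hω
    | succ s ih => rw [pow_succ']; exact hCM s _ ih
  have hsurj : ∀ s (c : ι → R), ∃ a : ι → R, ∃ η ∈ M s,
      (C ^ s) (∑ u, a u • e 0 u) = ∑ v, c v • e s v + (p : R) • η := by
    intro s
    induction s with
    | zero => exact fun c => ⟨c, 0, zero_mem _, by simp⟩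
    | succ s ih =>
      intro c
      obtain ⟨D, hD⟩ := (hB s).exists_left_inv
      obtain ⟨a, η, hη, h⟩ := ih (c ᵥ* D)
      obtain ⟨η', hη', h'⟩ := apply_sum_smul C e B hCe s (c ᵥ* D)
      rw [vecMul_vecMul, hD, vecMul_one] at h'
      refine ⟨a, η' + C η, add_mem hη' (hCM s _ hη), ?_⟩
      rw [pow_succ', Module.End.mul_apply, h, map_add, h', map_smul, smul_add, add_assoc]
  -- Newton-type step: C η lies in the span modulo p, and since C^(s+1) is onto that span modulo p
  -- (`hsurj`), changing a by p^s k cancels it.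
  have hstep : ∀ s (a : ι → R), (∃ η ∈ M s, (C ^ s) (ω - ∑ u, a u • e 0 u) = (p : R) ^ s • η) →
      ∃ k : ι → R, ∃ η ∈ M (s + 1),
        (C ^ (s + 1)) (ω - ∑ u, (a + (p : R) ^ s • k) u • e 0 u) = (p : R) ^ (s + 1) • η := by
    rintro s a ⟨η, hη, h⟩
    obtain ⟨c, ξ, hξ, hc⟩ := hC s η hη
    obtain ⟨k, ζ, hζ, hk⟩ := hsurj (s + 1) c
    refine ⟨k, ξ - ζ, sub_mem hξ hζ, ?_⟩
    have h1 : ω - ∑ u, (a + (p : R) ^ s • k) u • e 0 u =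
        (ω - ∑ u, a u • e 0 u) - (p : R) ^ s • ∑ u, k u • e 0 u := by
      simp_rw [Pi.add_apply, Pi.smul_apply, add_smul, Finset.sum_add_distrib, smul_assoc,
        ← Finset.smul_sum]
      abel
    rw [h1, map_sub, map_smul, hk, pow_succ', Module.End.mul_apply, h, map_smul, hc, ← smul_sub,
      add_sub_add_left_eq_sub, ← smul_sub, smul_smul, ← pow_succ]
  let A : ∀ s, {a : ι → R // ∃ η ∈ M s, (C ^ s) (ω - ∑ u, a u • e 0 u) = (p : R) ^ s • η} :=
    fun s => Nat.rec ⟨0, ω, hω, by simp⟩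
      (fun s a => ⟨a.1 + (p : R) ^ s • (hstep s a.1 a.2).choose,
        (hstep s a.1 a.2).choose_spec⟩) s
  have hA : ∀ s, ∃ k : ι → R, (A (s + 1)).1 = (A s).1 + (p : R) ^ s • k := fun s => ⟨_, rfl⟩
  choose k hk using hA
  have hAs : ∀ s, (A s).1 = ∑ j ∈ Finset.range s, (p : R) ^ j • k j := by
    intro s
    induction s with
    | zero => rfl
    | succ s ih => rw [hk, ih, Finset.sum_range_succ]
  choose a ha using fun u => exists_adic_sum (p := p) fun j => k j u
  refine ⟨a, fun s => ?_⟩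
  choose d hd using fun u => ha u s
  obtain ⟨η, hη, h⟩ := (A s).2
  -- Passing from the s-th approximation to the limit changes the coefficients by p^s d only.
  refine ⟨η - (C ^ s) (∑ u, d u • e 0 u), sub_mem hη (hiter s _ (hlc 0 d)), ?_⟩
  have h1 : ω - ∑ u, a u • e 0 u =
      (ω - ∑ u, (A s).1 u • e 0 u) - (p : R) ^ s • ∑ u, d u • e 0 u := by
    have h2 : ∀ u, a u = (A s).1 u + (p : R) ^ s * d u := by
      intro u
      rw [← hd u, hAs, Finset.sum_apply]
      simp
    simp_rw [h2, add_smul, Finset.sum_add_distrib, mul_smul, ← Finset.smul_sum]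
    abel
  rw [h1, map_sub, h, map_smul, smul_sub]

/-- If a = p^k d, then cancelling p^k shows that C^(k+1) of the combination with coefficients d is
divisible by p. Invertibility of the B i makes C^(k+1) injective modulo p on coefficients, so p ∣ d;
thus a is divisible by every power of p. -/
theorem eq_zero_of_pow_dvd_iterate [DecidableEq ι] [IsAdicComplete (Ideal.span {(p : R)}) R]
    (hB : ∀ i, IsUnit (B i)) (htf : ∀ x y : V, (p : R) • x = (p : R) • y → x = y)
    (hind : ∀ i (a : ι → R), (∃ x, ∑ u, a u • e i u = (p : R) • x) → ∀ u, (p : R) ∣ a u)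
    (hCe : ∀ i u, ∃ x, C (e i u) = ∑ v, B i u v • e (i + 1) v + (p : R) • x)
    {a : ι → R} (h : ∀ s, ∃ x, (C ^ s) (∑ u, a u • e 0 u) = (p : R) ^ s • x) : a = 0 := by
  have hinj : ∀ s (a : ι → R), ∃ c : ι → R,
      (∃ x, (C ^ s) (∑ u, a u • e 0 u) = ∑ v, c v • e s v + (p : R) • x) ∧
        ((∀ v, (p : R) ∣ c v) → ∀ u, (p : R) ∣ a u) := by
    intro s a
    induction s with
    | zero => exact ⟨a, ⟨0, by simp⟩, id⟩
    | succ s ih =>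
      obtain ⟨c, ⟨x, hx⟩, hc⟩ := ih
      obtain ⟨y, -, hy⟩ := apply_sum_smul (M := fun _ => ⊤) C e B (by simpa using hCe) s c
      refine ⟨c ᵥ* B s, ⟨y + C x, ?_⟩, fun hdvd => hc fun v => ?_⟩
      · rw [pow_succ', Module.End.mul_apply, hx, map_add, hy, map_smul, smul_add, add_assoc]
      · obtain ⟨D, hD⟩ := (hB s).exists_right_inv
        rw [← vecMul_one c, ← hD, ← vecMul_vecMul]
        exact Finset.dvd_sum fun u _ => (hdvd u).mul_right _
  have htf' : ∀ k (x y : V), (p : R) ^ k • x = (p : R) ^ k • y → x = y := by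
    intro k
    induction k with
    | zero => intro x y; simp
    | succ k ih =>
      intro x y hxy
      rw [pow_succ, mul_smul, mul_smul] at hxy
      exact htf _ _ (ih _ _ hxy)
  have hk : ∀ k u, (p : R) ^ k ∣ a u := by
    intro k
    induction k with
    | zero => simp
    | succ k ih =>
      choose d hd using ih
      obtain ⟨x, hx⟩ := h (k + 1)
      have h1 : ∑ u, a u • e 0 u = (p : R) ^ k • ∑ u, d u • e 0 u := by
        simp_rw [hd, mul_smul, Finset.smul_sum]
      rw [h1, map_smul, pow_succ (p : R), mul_smul] at hx
      have hx' := htf' k _ _ hx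
      obtain ⟨c, ⟨y, hy⟩, hc⟩ := hinj (k + 1) d
      rw [hx', ← sub_eq_iff_eq_add, ← smul_sub] at hy
      intro u
      rw [hd, pow_succ]
      exact mul_dvd_mul_left _ (hc (hind _ c ⟨_, hy.symm⟩) u)
  funext u
  exact eq_zero_of_forall_pow_dvd fun k => hk k u

end UnitRoot

/-! ### C_p modulo p on Ω_f: the case of all p and the case of odd p. -/

section Cartier

variable {R : Type*} [CommRing R] {n : ℕ} {p : ℕ} {ℓ : (Fin n → ℤ) →+ ℝ} {b : Fin n → ℤ}
  {Δ μ : Set (Fin n → ℝ)} {f : Laurent R n} {σ : R →+* R}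

/-- A Laurent polynomial supported in the convex set `Δ` with a vertex at `b`, together with an
open subset `μ` of `Δ`, all of whose dilates contain finitely many integral points. -/
structure Admissible (ℓ : (Fin n → ℤ) →+ ℝ) (b : Fin n → ℤ) (Δ μ : Set (Fin n → ℝ))
    (f : Laurent R n) : Prop where
  isVertex : IsVertex ℓ b f
  supp : f ∈ suppIn R 1 Δ
  convex : Convex ℝ Δ
  absorbing : Absorbing Δ μ
  finite : ∀ k : ℕ, {u : Fin n → ℤ | toReal u ∈ (k : ℝ) • μ}.Finite

/-- Δ is only required to contain the exponents of f: σ is not assumed injective, so the Newton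
polytope of f^σ could be smaller. -/
theorem Admissible.map_twist (h : Admissible ℓ b Δ μ f) (σ : R →+* R) :
    Admissible ℓ b Δ μ (twist σ f) :=
  ⟨h.isVertex.map_twist σ, twist_mem_suppIn σ h.supp, h.convex, h.absorbing, h.finite⟩

theorem Admissible.iterate_twist (h : Admissible ℓ b Δ μ f) (σ : R →+* R) (s : ℕ) :
    Admissible ℓ b Δ μ ((twist σ)^[s] f) := by
  induction s with
  | zero => exact h
  | succ s ih => rw [Function.iterate_succ_apply']; exact ih.map_twist σ

variable {P : Finset (Fin n → ℤ)}

theorem expansion_eq_sum_omega (hf : IsVertex ℓ b f) (hP : ∀ u, u ∈ P ↔ toReal u ∈ μ)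
    {y : Laurent R n} (hy : y ∈ suppIn R 1 μ) :
    expansion b f y 1 = ∑ v : P, y.coeff v • omega b f v := by
  have h : y = ∑ v : P, y.coeff v • AddMonoidAlgebra.single (v : Fin n → ℤ) (1 : R) := by
    rw [Finset.sum_coe_sort P fun v => y.coeff v • AddMonoidAlgebra.single v (1 : R)]
    have hsub : y.coeff.support ⊆ P := fun u hu =>
      (hP u).2 (by simpa using hy u (Finsupp.mem_support_iff.1 hu))
    conv_lhs => rw [← AddMonoidAlgebra.sum_coeff_single y]
    rw [Finsupp.sum, Finset.sum_subset hsub fun u _ hu => by simp [Finsupp.notMem_support_iff.1 hu]]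
    simp [AddMonoidAlgebra.smul_single]
  conv_lhs => rw [h]
  rw [hf.expansion_sum]
  exact Finset.sum_congr rfl fun v _ => hf.expansion_smul _ _ _

theorem isExpansionSum_omega [hp : Fact p.Prime] (hf : IsVertex ℓ b f) {u : Fin n → ℤ} (hu : toReal u ∈ μ) :
    IsExpansionSum p b μ f (Pi.single 0 (AddMonoidAlgebra.single u 1)) (omega b f u) := by
  refine ⟨fun j => ?_, fun N => ?_⟩
  · rcases eq_or_ne j 0 with rfl | hj
    · rw [Pi.single_eq_same]
      intro v hv
      have : u = v := by
        by_contra hne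
        exact hv (by simp [hne])
      simpa [← this] using hu
    · rw [Pi.single_eq_of_ne hj]
      exact zero_mem _
  · rcases Nat.eq_zero_or_pos N with rfl | hN
    · simpa using smul_mem_multiples (1 : R) _
    · rw [Finset.sum_eq_single_of_mem 0 (Finset.mem_range.2 (Nat.mul_pos hp.out.pos hN))
        fun j _ hj => ?_]
      · simp [omega]
      · rw [Pi.single_eq_of_ne hj,
          show expansion b f 0 (j + 1) = 0 from map_zero (hf.expansionHom _), smul_zero]

theorem omega_mem_Omega {u : Fin n → ℤ} (hu : toReal u ∈ μ) : omega b f u ∈ Omega b μ f := by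
  refine Submodule.subset_span ⟨1, AddMonoidAlgebra.single u 1, le_rfl, fun v hv => ?_, by simp [omega]⟩
  have : u = v := by
    by_contra hne
    exact Finsupp.mem_support_iff.1 hv (by simp [hne])
  simpa [← this] using hu

theorem natCast_prime_ne_zero [CharZero R] [hp : Fact p.Prime] : (p : R) ≠ 0 := Nat.cast_ne_zero.2 hp.out.ne_zero

variable [hp : Fact p.Prime] [IsDomain R] [CharZero R]

theorem IsExpansionSum.exists_cartier_eq (hf : Admissible ℓ b Δ μ f) (hσ : IsFrobeniusLift p σ)
    {c : ℕ → R} (hc : ∀ r, (r.factorial : R) * c r = (p : R) ^ r)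
    {e : ℕ → ℕ} (he : ∀ J r, 1 ≤ J + r → (p : R) ^ (e (J + r) + 1) ∣ (p : R) ^ J * c r)
    {g : ℕ → Laurent R n} {ω : Formal R n} (h : IsExpansionSum p b μ f g ω) :
    ∃ (y : ℕ → Laurent R n) (η : Formal R n), (∀ l, y l ∈ suppIn R (l + 1) μ) ∧
      cartier R n p ω = expansion b (twist σ f) (cartierPoly p
        (∑ i ∈ Finset.range p, (i.factorial : R) • (f ^ (p - 1 - i) * g i))) 1 + (p : R) • η ∧
      ∀ N, η - ∑ l ∈ Finset.range (N + 1), ((l.factorial : R) * (p : R) ^ e l) •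
        expansion b (twist σ f) (y l) (l + 1) ∈ multiples n ((p : R) ^ N) := by
  obtain ⟨G, hGs, hG⟩ := exists_pow_eq_expand_twist_add_suppIn hσ hf.convex hf.supp
  have hp0 : (p : R) ≠ 0 := natCast_prime_ne_zero
  have hF := hf.isVertex.map_twist σ
  -- Only the l = 0 term is not divisible by p. One factor p is taken out of all others to form η,
  -- whose own term of index 0 is therefore 0.
  set E : ℕ → ℕ := fun l => if l = 0 then 0 else e l + 1 with hE
  have hd : ∀ J r, ∃ d, (p : R) ^ J * c r = (p : R) ^ E (J + r) * d := by
    intro J r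
    by_cases h0 : J + r = 0
    · exact ⟨(p : R) ^ J * c r, by simp only [hE, if_pos h0, pow_zero, one_mul]⟩
    · obtain ⟨d, hd⟩ := he J r (by omega)
      exact ⟨d, by simp only [hE, if_neg h0, hd]⟩
  choose d hd using hd
  have hd0 : d 0 0 = 1 := by
    have h1 := hd 0 0
    have h2 := hc 0
    simp only [Nat.factorial_zero, Nat.cast_one, one_mul, pow_zero] at h2
    simpa [hE, h2] using h1.symm
  obtain ⟨y, hy, hy0, hys⟩ := h.exists_cartier hf.isVertex hF hf.supp hf.absorbing hG hGs hc hd hd0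
  have hsplit : ∀ N, ∑ l ∈ Finset.range (N + 1), ((l.factorial : R) * (p : R) ^ E l) •
        expansion b (twist σ f) (y l) (l + 1) = expansion b (twist σ f) (y 0) 1 +
      (p : R) • ∑ l ∈ Finset.range (N + 1), ((l.factorial : R) * (p : R) ^ e l) •
        expansion b (twist σ f) (if l = 0 then 0 else y l) (l + 1) := by
    intro N
    rw [Finset.sum_range_succ', Finset.sum_range_succ', smul_add, Finset.smul_sum, add_comm]
    congr 1
    · simp [hE]
    · rw [if_pos rfl, zero_add, show expansion b (twist σ f) 0 1 = 0 from map_zero (hF.expansionHom _),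
        smul_zero, smul_zero, add_zero]
      refine Finset.sum_congr rfl fun l _ => ?_
      rw [if_neg (Nat.succ_ne_zero l), smul_smul]
      simp only [hE, if_neg (Nat.succ_ne_zero l)]
      congr 1
      ring
  have h1 := hys 1
  rw [hsplit 0] at h1
  obtain ⟨η, hη⟩ : ∃ η : Formal R n, cartier R n p ω - expansion b (twist σ f) (y 0) 1 = (p : R) • η := by
    rw [← mem_multiples_iff_exists]
    rw [pow_one, ← sub_sub] at h1
    exact (Submodule.sub_mem_iff_left _ (smul_mem_multiples _ _)).1 h1
  refine ⟨fun l => if l = 0 then 0 else y l, η, fun l => ?_, ?_, fun N => ?_⟩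
  · dsimp only
    split_ifs
    · exact zero_mem _
    · exact hy l
  · rw [← hy0, ← hη, add_sub_cancel]
  · have h2 := hys (N + 1)
    rw [hsplit N, ← sub_sub, hη, ← smul_sub, pow_succ'] at h2
    exact mem_multiples_of_smul hp0 h2

theorem IsExpansionSum.exists_cartier_eq_expansionSums
    [IsAdicComplete (Ideal.span {(p : R)}) R] (hf : Admissible ℓ b Δ μ f)
    (hσ : IsFrobeniusLift p σ) {g : ℕ → Laurent R n} {ω : Formal R n}
    (h : IsExpansionSum p b μ f g ω) :
    ∃ η, (∃ y, IsExpansionSum p b μ (twist σ f) y η) ∧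
      cartier R n p ω = expansion b (twist σ f) (cartierPoly p
        (∑ i ∈ Finset.range p, (i.factorial : R) • (f ^ (p - 1 - i) * g i))) 1 + (p : R) • η := by
  have hF := (hf.map_twist σ).isVertex
  choose c hc hcp _ using exists_factorial_mul_eq_pow (R := R) p
  obtain ⟨y, η, hy, hη, hs⟩ := h.exists_cartier_eq hf hσ hc (e := fun _ => 0) fun J r hJr => by
    rcases Nat.eq_zero_or_pos r with rfl | hr
    · exact (pow_dvd_pow _ (by omega)).mul_right _
    · simpa using (hcp r hr).mul_left _
  refine ⟨η, ⟨y, hy, fun N => ?_⟩, hη⟩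
  rcases Nat.eq_zero_or_pos N with rfl | hN
  · simpa using smul_mem_multiples (1 : R) η
  have h2 : 2 * N ≤ p * N := Nat.mul_le_mul_right _ hp.out.two_le
  have h1 := hs (p * N - 1)
  rw [Nat.sub_add_cancel (by omega)] at h1
  simp only [pow_zero, mul_one] at h1
  exact multiples_anti (pow_dvd_pow _ (by omega)) h1

/-- For odd p the term of index l carries p^(l/2) as a multiple inside Ω, so the partial sums over l
≤ 2N are Cauchy in the p-adic topology of Ω, not just coefficientwise. -/
theorem IsExpansionSum.exists_cartier_eq_completedOmega
    [IsAdicComplete (Ideal.span {(p : R)}) R] (hp2 : p ≠ 2) (hf : Admissible ℓ b Δ μ f)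
    (hσ : IsFrobeniusLift p σ) {g : ℕ → Laurent R n} {ω : Formal R n}
    (h : IsExpansionSum p b μ f g ω) :
    ∃ η ∈ completedOmega p b μ (twist σ f),
      cartier R n p ω = expansion b (twist σ f) (cartierPoly p
        (∑ i ∈ Finset.range p, (i.factorial : R) • (f ^ (p - 1 - i) * g i))) 1 + (p : R) • η := by
  choose c hc _ hcp using exists_factorial_mul_eq_pow (R := R) p
  obtain ⟨y, η, hy, hη, hs⟩ := h.exists_cartier_eq hf hσ hc (e := fun l => l / 2)
    fun J r hJr => by
      rcases Nat.eq_zero_or_pos r with rfl | hr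
      · exact (pow_dvd_pow _ (by omega)).mul_right _
      · refine (pow_dvd_pow _ ?_).trans (pow_add (p : R) J (r / 2 + 1) ▸
          mul_dvd_mul_left _ (hcp r hp2 hr))
        omega
  have hmem : ∀ l (c : R), (l.factorial * c) • expansion b (twist σ f) (y l) (l + 1) ∈
      Omega b μ (twist σ f) := by
    intro l c
    rw [mul_comm, mul_smul]
    exact Submodule.smul_mem _ _ (factorial_smul_expansion_mem_Omega (hy l))
  refine ⟨η, mem_completedOmega_iff.2 ⟨fun N => ⟨_, sum_mem (t := Finset.range (2 * N + 1))
    fun l _ => hmem l ((p : R) ^ (l / 2))⟩, fun N => ?_, fun N => ?_⟩, hη⟩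
  · refine ⟨⟨_, add_mem (hmem (2 * N + 1) 1) (hmem (2 * N + 2) (p : R))⟩, Subtype.ext ?_⟩
    simp only [AddSubgroupClass.coe_sub, SetLike.val_smul]
    rw [show 2 * (N + 1) + 1 = 2 * N + 1 + 1 + 1 by ring, Finset.sum_range_succ,
      Finset.sum_range_succ, add_assoc, add_sub_cancel_left, smul_add, smul_smul, smul_smul,
      show (2 * N + 1) / 2 = N by omega, show (2 * N + 1 + 1) / 2 = N + 1 by omega]
    congr 2 <;> ring
  · exact multiples_anti (pow_dvd_pow _ (by omega)) (hs (2 * N))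

end Cartier

/-! ### Unit root decomposition for the Cartier operator. -/

section Decomposition

variable {R : Type*} [CommRing R] {n : ℕ} {p : ℕ} {ℓ : (Fin n → ℤ) →+ ℝ} {b : Fin n → ℤ}
  {Δ μ : Set (Fin n → ℝ)} {f : Laurent R n} {σ : R →+* R} {P : Finset (Fin n → ℤ)}

/-- The Hasse–Witt matrix of `f` with respect to a finite set of exponents. -/
def hasseWittOn (p : ℕ) (P : Finset (Fin n → ℤ)) (f : Laurent R n) : Matrix P P R :=
  Matrix.of fun u v => (f ^ (p - 1)).coeff (p • (v : Fin n → ℤ) - u)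

theorem twist_pow (σ : R →+* R) (f : Laurent R n) (k : ℕ) : twist σ (f ^ k) = twist σ f ^ k :=
  map_pow _ _ _

theorem isUnit_hasseWittOn_iterate_twist (h : IsUnit (hasseWittOn p P f)) (σ : R →+* R) (s : ℕ) :
    IsUnit (hasseWittOn p P ((twist σ)^[s] f)) := by
  classical
  induction s with
  | zero => exact h
  | succ s ih =>
    rw [Function.iterate_succ_apply']
    have h1 := ih.map σ.mapMatrix
    convert h1 using 1
    ext u v
    simp only [hasseWittOn, Matrix.of_apply, RingHom.mapMatrix_apply, Matrix.map_apply,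
      ← twist_pow, coeff_twist]

theorem Admissible.sum_numerators_mem (hf : Admissible ℓ b Δ μ f) {g : ℕ → Laurent R n}
    (hg : ∀ j, g j ∈ suppIn R (j + 1) μ) :
    ∑ i ∈ Finset.range p, (i.factorial : R) • (f ^ (p - 1 - i) * g i) ∈ suppIn R (p * 1) μ := by
  refine sum_mem fun i hi => Submodule.smul_mem _ _ ?_
  have hi' := Finset.mem_range.1 hi
  have := hf.absorbing.mul_pow_mem_suppIn (by omega) (hg i) hf.supp (p - 1 - i)
  rwa [mul_one, show i + 1 + (p - 1 - i) = p * 1 by omega, mul_comm (g i)] at this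

theorem expansion_cartier_numerator_omega [hp : Fact p.Prime] (hf : Admissible ℓ b Δ μ f)
    (hP : ∀ u, u ∈ P ↔ toReal u ∈ μ) (u : P) :
    expansion b (twist σ f) (cartierPoly p (∑ i ∈ Finset.range p, (i.factorial : R) •
      (f ^ (p - 1 - i) * (Pi.single 0 (AddMonoidAlgebra.single (u : Fin n → ℤ) 1) : ℕ → Laurent R n) i))) 1 =
      ∑ v : P, hasseWittOn p P f u v • omega b (twist σ f) v := by
  have hu := isExpansionSum_omega (p := p) hf.isVertex ((hP u).1 u.2)
  rw [expansion_eq_sum_omega (hf.map_twist σ).isVertex hP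
    (cartierPoly_mem_suppIn (hf.sum_numerators_mem hu.supp))]
  refine Finset.sum_congr rfl fun v _ => ?_
  rw [Finset.sum_eq_single_of_mem 0 (Finset.mem_range.2 hp.out.pos) fun i _ hi => ?_]
  · rw [coeff_cartierPoly, Pi.single_eq_same, Nat.factorial_zero, Nat.cast_one, one_smul, Nat.sub_zero,
      AddMonoidAlgebra.coeff_mul_single_apply, mul_one, ← sub_eq_add_neg]
    rfl
  · rw [Pi.single_eq_of_ne hi, mul_zero, smul_zero]

variable [hp : Fact p.Prime] [IsAdicComplete (Ideal.span {(p : R)}) R]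

/-- The family M is kept abstract so that the argument serves both the series ∑ j! g_j/f^(j+1), for
all p, and the completion of Ω, for odd p. -/
theorem exists_decomposition_of_le (hf : Admissible ℓ b Δ μ f) (hP : ∀ u, u ∈ P ↔ toReal u ∈ μ)
    (hβ : IsUnit (hasseWittOn p P f)) {M : ℕ → Submodule R (Formal R n)}
    (hM : ∀ i, ∀ ω ∈ M i, ∃ g, IsExpansionSum p b μ ((twist σ)^[i] f) g ω)
    (hΩ : ∀ i, Omega b μ ((twist σ)^[i] f) ≤ M i)
    (hC : ∀ i g ω, IsExpansionSum p b μ ((twist σ)^[i] f) g ω → ∃ η ∈ M (i + 1),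
      cartier R n p ω = expansion b (twist σ ((twist σ)^[i] f)) (cartierPoly p
        (∑ j ∈ Finset.range p, (j.factorial : R) •
          (((twist σ)^[i] f) ^ (p - 1 - j) * g j))) 1 + (p : R) • η)
    {ω : Formal R n} (hω : ω ∈ M 0) :
    ∃ a : P → R, ∀ s, ∃ η ∈ M s,
      (cartier R n p)^[s] (ω - ∑ u : P, a u • omega b f u) = (p : R) ^ s • η := by
  classical
  have hfi := hf.iterate_twist σ
  obtain ⟨a, ha⟩ := exists_unitRoot_decomposition (p := p) (ι := P) (cartier R n p)
    (fun i u => omega b ((twist σ)^[i] f) u) (fun i => hasseWittOn p P ((twist σ)^[i] f)) (M := M)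
    (isUnit_hasseWittOn_iterate_twist hβ σ)
    (fun i u => hΩ i (omega_mem_Omega ((hP u).1 u.2)))
    (fun i ω hω => by
      obtain ⟨g, hg⟩ := hM i ω hω
      obtain ⟨η, hη, h⟩ := hC i g ω hg
      rw [expansion_eq_sum_omega ((hfi i).map_twist σ).isVertex hP
        (cartierPoly_mem_suppIn ((hfi i).sum_numerators_mem hg.supp))] at h
      exact ⟨_, η, hη, by rw [h, Function.iterate_succ_apply']⟩)
    (fun i u => by
      obtain ⟨η, hη, h⟩ := hC i _ _ (isExpansionSum_omega (hfi i).isVertex ((hP u).1 u.2))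
      rw [expansion_cartier_numerator_omega (hfi i) hP u] at h
      exact ⟨η, hη, by rw [h, Function.iterate_succ_apply']⟩) hω
  refine ⟨a, fun s => ?_⟩
  obtain ⟨η, hη, h⟩ := ha s
  exact ⟨η, hη, by rw [← h, Module.End.pow_apply]; rfl⟩

variable [IsDomain R] [CharZero R]

theorem IsExpansionSum.exists_decomposition (hf : Admissible ℓ b Δ μ f)
    (hσ : IsFrobeniusLift p σ) (hP : ∀ u, u ∈ P ↔ toReal u ∈ μ)
    (hβ : IsUnit (hasseWittOn p P f)) {g : ℕ → Laurent R n} {ω : Formal R n}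
    (hω : IsExpansionSum p b μ f g ω) :
    ∃ a : P → R, ∀ s, ∃ η,
      (cartier R n p)^[s] (ω - ∑ u : P, a u • omega b f u) = (p : R) ^ s • η := by
  have hfi := hf.iterate_twist σ
  obtain ⟨a, ha⟩ := exists_decomposition_of_le (σ := σ) hf hP hβ
    (M := fun i => (hfi i).isVertex.expansionSums p μ) (fun i ω hω => hω)
    (fun i => Omega_le_completedOmega.trans ((hfi i).isVertex.completedOmega_le hf.finite))
    (fun i g ω h => by
      obtain ⟨η, ⟨y, hy⟩, h⟩ := h.exists_cartier_eq_expansionSums (hfi i) hσ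
      exact ⟨η, ⟨y, by rwa [Function.iterate_succ_apply']⟩, h⟩)
    (ω := ω) ⟨g, hω⟩
  exact ⟨a, fun s => (ha s).imp fun η h => h.2⟩

theorem exists_sub_mem_formalDerivatives (hp2 : p ≠ 2) (hf : Admissible ℓ b Δ μ f)
    (hσ : IsFrobeniusLift p σ) (hP : ∀ u, u ∈ P ↔ toReal u ∈ μ)
    (hβ : IsUnit (hasseWittOn p P f)) {ω : Formal R n} (hω : ω ∈ completedOmega p b μ f) :
    ∃ a : P → R, ω - ∑ u : P, a u • omega b f u ∈ formalDerivatives p b μ σ f := by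
  have hfi := hf.iterate_twist σ
  obtain ⟨a, ha⟩ := exists_decomposition_of_le (σ := σ) hf hP hβ
    (M := fun i => completedOmega p b μ ((twist σ)^[i] f))
    (fun i ω hω => (hfi i).isVertex.completedOmega_le hf.finite hω)
    (fun i => Omega_le_completedOmega)
    (fun i g ω h => by
      obtain ⟨η, hη, h⟩ := h.exists_cartier_eq_completedOmega hp2 (hfi i) hσ
      exact ⟨η, by rwa [Function.iterate_succ_apply'], h⟩) hω
  refine ⟨a, ?_, fun s _ => ha s⟩
  obtain ⟨η, hη, h⟩ := ha 0
  rw [pow_zero, one_smul] at h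
  rw [show ω - ∑ u : P, a u • omega b f u = η from h]
  exact hη

theorem eq_zero_of_iterate_cartier_sum_omega (hf : Admissible ℓ b Δ μ f)
    (hσ : IsFrobeniusLift p σ) (hP : ∀ u, u ∈ P ↔ toReal u ∈ μ)
    (hβ : IsUnit (hasseWittOn p P f)) {a : P → R}
    (h : ∀ s, ∃ x, (cartier R n p)^[s] (∑ u : P, a u • omega b f u) = (p : R) ^ s • x) : a = 0 := by
  classical
  have hfi := hf.iterate_twist σ
  refine eq_zero_of_pow_dvd_iterate (p := p) (ι := P) (cartier R n p)
    (fun i u => omega b ((twist σ)^[i] f) u) (fun i => hasseWittOn p P ((twist σ)^[i] f))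
    (isUnit_hasseWittOn_iterate_twist hβ σ)
    (fun x y hxy => smul_right_injective _ natCast_prime_ne_zero hxy)
    (fun i a ha u => ?_) (fun i u => ?_) (fun s => ?_)
  -- Multiplying by the denominator turns the combination into ∑ a_v x^v, whose coefficient at u is
  -- a_u.
  · have h1 := act_mem_multiples ((twist σ)^[i] f ^ 1) (mem_multiples_iff_exists.2 ha) u
    simp_rw [map_sum, map_smul, omega, (hfi i).isVertex.act_expansion] at h1
    rw [Finset.sum_apply, Finset.sum_eq_single_of_mem u (Finset.mem_univ u) fun v _ hv => ?_] at h1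
    · simpa only [Pi.smul_apply, AddMonoidAlgebra.coeff_single, Finsupp.single_eq_same, smul_eq_mul,
        mul_one] using h1
    · rw [Pi.smul_apply, AddMonoidAlgebra.coeff_single, Finsupp.single_eq_of_ne fun h => hv (Subtype.ext h.symm),
        smul_zero]
  · obtain ⟨η, -, h⟩ := (isExpansionSum_omega (hfi i).isVertex
      ((hP u).1 u.2)).exists_cartier_eq_expansionSums (hfi i) hσ
    rw [expansion_cartier_numerator_omega (hfi i) hP u] at h
    exact ⟨η, by rw [h, Function.iterate_succ_apply']⟩
  · obtain ⟨x, hx⟩ := h s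
    exact ⟨x, by rw [← hx, Module.End.pow_apply]; rfl⟩

end Decomposition

/-! ### Periods under the Cartier operator and under derivations. -/

section Periods

variable {R : Type*} [CommRing R] {n : ℕ} {p : ℕ} {ℓ : (Fin n → ℤ) →+ ℝ} {b : Fin n → ℤ}
  {Δ μ : Set (Fin n → ℝ)} {f : Laurent R n} {σ : R →+* R}

theorem pow_dvd_pow_sub_expand_pow [Fact p.Prime] (hσ : IsFrobeniusLift p σ) (g : Laurent R n)
    {m s : ℕ} (hm : p ^ s ∣ m) :
    (p : Laurent R n) ^ (s + 1) ∣ g ^ (p * m) - expand p (twist σ g ^ m) := by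
  obtain ⟨q, rfl⟩ := hm
  obtain ⟨G, hG⟩ := exists_pow_eq_expand_twist_add hσ g
  have h : (p : Laurent R n) ∣ g ^ p - expand p (twist σ g) := ⟨G, by rw [hG, add_sub_cancel_left]⟩
  rw [pow_mul g, map_pow, pow_mul, pow_mul]
  exact (dvd_sub_pow_of_dvd_sub h s).trans (sub_dvd_pow_sub_pow _ _ _)

theorem pow_dvd_constantTerm_sub [Fact p.Prime] (hσ : IsFrobeniusLift p σ) (g : Laurent R n)
    {m s : ℕ} (hm : p ^ s ∣ m) (ω : Formal R n) :
    (p : R) ^ (s + 1) ∣ constantTerm (g ^ (p * m)) ω -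
      constantTerm (twist σ g ^ m) (cartier R n p ω) := by
  obtain ⟨z, hz⟩ := pow_dvd_pow_sub_expand_pow hσ g hm
  have hz' : g ^ (p * m) = expand p (twist σ g ^ m) + (p : R) ^ (s + 1) • z := by
    rw [← sub_eq_iff_eq_add', hz, ← Nat.cast_pow, ← Nat.cast_pow, Nat.cast_smul_eq_nsmul, nsmul_eq_mul]
  rw [constantTerm_eq, constantTerm_eq, ← cartier_act_expand, cartier_apply, smul_zero, hz', map_add,
    map_smul]
  simp

/-- With m = pq and C_p(ω) = pη, the period of ω is congruent to p times that of η for (g^σ)^q, and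
η inherits the hypothesis after cancelling p. The induction keeps g general because g is replaced by
g^σ. -/
theorem pow_dvd_constantTerm_pow [hp : Fact p.Prime] [IsDomain R] [CharZero R]
    (hσ : IsFrobeniusLift p σ) (s : ℕ) : ∀ (g : Laurent R n) {m : ℕ}, p ^ s ∣ m →
    ∀ {ω : Formal R n}, (∀ t, ∃ x, (cartier R n p)^[t] ω = (p : R) ^ t • x) →
      (p : R) ^ s ∣ constantTerm (g ^ m) ω := by
  induction s with
  | zero => simp
  | succ s ih =>
    intro g m hm ω hω
    obtain ⟨q, rfl⟩ := (Dvd.intro_left _ rfl : p ∣ p ^ s * p).trans hm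
    have hq : p ^ s ∣ q := Nat.dvd_of_mul_dvd_mul_left hp.out.pos (by rwa [← pow_succ'])
    refine (dvd_sub_right ?_).1 ((dvd_sub_comm).1 (pow_dvd_constantTerm_sub hσ g hq ω))
    obtain ⟨η, hη⟩ := hω 1
    rw [Function.iterate_one, pow_one] at hη
    rw [hη, constantTerm_eq, map_smul, Pi.smul_apply, smul_eq_mul, pow_succ', ← constantTerm_eq]
    refine mul_dvd_mul_left _ (ih _ hq fun t => ?_)
    obtain ⟨x, hx⟩ := hω (t + 1)
    rw [Function.iterate_succ_apply, hη, ← Module.End.pow_apply, map_smul, pow_succ' (p : R), mul_smul,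
      Module.End.pow_apply] at hx
    exact ⟨x, smul_right_injective _ natCast_prime_ne_zero hx⟩

theorem map_act (σ : R →+* R) (g : Laurent R n) (ω : Formal R n) (e : Fin n → ℤ) :
    σ (act g ω e) = act (twist σ g) (fun e => σ (ω e)) e := by
  induction g using AddMonoidAlgebra.induction_linear with
  | zero => simp [twist]
  | add x y hx hy =>
    rw [show twist σ (x + y) = twist σ x + twist σ y from map_add _ _ _, map_add, map_add,
      LinearMap.add_apply, LinearMap.add_apply, Pi.add_apply, Pi.add_apply, map_add, hx, hy]
  | single w c => rw [twist, AddMonoidAlgebra.mapRingHom_single, act_single, act_single, map_mul]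

theorem map_omega (hf : IsVertex ℓ b f) (σ : R →+* R) (u : Fin n → ℤ) :
    (fun e => σ (omega b f u e)) = omega b (twist σ f) u := by
  refine (hf.map_twist σ).eq_expansion ?_ ?_
  · obtain ⟨c, hc⟩ := hf.expansion_mem (AddMonoidAlgebra.single u 1) 1
    exact ⟨c, fun e he => hc e fun h => he ((congrArg σ h).trans (map_zero σ))⟩
  · funext e
    rw [← twist_pow, ← map_act, omega, hf.act_expansion, ← coeff_twist, twist,
      AddMonoidAlgebra.mapRingHom_single, map_one]

/-- The action of a derivation on the coefficients of Laurent polynomials. -/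
def derivCoeffs (δ : Derivation ℤ R R) (g : Laurent R n) : Laurent R n :=
  AddMonoidAlgebra.map (δ : R →ₗ[ℤ] R).toAddMonoidHom g

theorem coeff_derivCoeffs (δ : Derivation ℤ R R) (g : Laurent R n) (e : Fin n → ℤ) :
    (derivCoeffs δ g).coeff e = δ (g.coeff e) := by
  simp [derivCoeffs]

theorem deriv_act (δ : Derivation ℤ R R) (g : Laurent R n) (ω : Formal R n) :
    (fun e => δ (act g ω e)) = act (derivCoeffs δ g) ω + act g (fun e => δ (ω e)) := by
  funext e
  induction g using AddMonoidAlgebra.induction_linear with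
  | zero => simp [derivCoeffs]
  | add x y hx hy =>
    simp only [derivCoeffs, AddMonoidAlgebra.map_add, map_add, LinearMap.add_apply, Pi.add_apply] at *
    rw [hx, hy]
    ring
  | single w c =>
    rw [derivCoeffs, AddMonoidAlgebra.map_single, Pi.add_apply, act_single, act_single, act_single,
      Derivation.leibniz, smul_eq_mul, smul_eq_mul]
    change _ = δ c * _ + _
    ring

theorem derivCoeffs_mul (δ : Derivation ℤ R R) (g h : Laurent R n) :
    derivCoeffs δ (g * h) = derivCoeffs δ g * h + g * derivCoeffs δ h := by
  refine AddMonoidAlgebra.coeff_injective (DFunLike.coe_injective ?_)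
  have h1 := deriv_act δ g h.coeff
  rw [act_coeff, act_coeff, show (fun e => δ (h.coeff e)) = (derivCoeffs δ h).coeff from
    funext fun e => (coeff_derivCoeffs δ h e).symm, act_coeff] at h1
  exact (funext fun e => coeff_derivCoeffs δ _ e).trans h1

theorem derivCoeffs_pow (δ : Derivation ℤ R R) (g : Laurent R n) (m : ℕ) :
    derivCoeffs δ (g ^ m) = (m : R) • (g ^ (m - 1) * derivCoeffs δ g) := by
  rw [Nat.cast_smul_eq_nsmul, nsmul_eq_mul]
  induction m with
  | zero => simp [derivCoeffs, AddMonoidAlgebra.one_def, AddMonoidAlgebra.map_single]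
  | succ m ih =>
    rw [pow_succ, derivCoeffs_mul, ih]
    rcases m with _ | m
    · simp
    · simp only [Nat.add_sub_cancel]
      push_cast
      ring

theorem deriv_omega (hf : IsVertex ℓ b f) (δ : Derivation ℤ R R) (u : Fin n → ℤ) :
    (fun e => δ (omega b f u e)) =
      expansion b f (-(AddMonoidAlgebra.single u 1 * derivCoeffs δ f)) 2 := by
  have hω := hf.expansion_mem (AddMonoidAlgebra.single u 1) 1
  have h1 := hf.act_expansion (AddMonoidAlgebra.single u 1) 1
  rw [pow_one] at h1
  refine hf.eq_expansion ?_ ?_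
  · obtain ⟨c, hc⟩ := hω
    exact ⟨c, fun e he => hc e fun h => he ((congrArg δ h).trans (map_zero δ))⟩
  · have h2 := deriv_act δ f (omega b f u)
    rw [omega, h1, show (fun e => δ ((AddMonoidAlgebra.single u (1 : R)).coeff e)) = 0 from
      funext fun e => by by_cases h : u = e <;> simp [h]] at h2
    rw [pow_two, act_mul, omega, ← sub_eq_iff_eq_add'.2 h2, zero_sub, map_neg, ← act_mul, mul_comm f,
      act_mul, h1, act_coeff, mul_comm]
    rfl

theorem deriv_omega_mem_Omega (hf : Admissible ℓ b Δ μ f) (δ : Derivation ℤ R R) {u : Fin n → ℤ}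
    (hu : toReal u ∈ μ) : (fun e => δ (omega b f u e)) ∈ Omega b μ f := by
  rw [deriv_omega hf.isVertex]
  have h : -(AddMonoidAlgebra.single u 1 * derivCoeffs δ f) ∈ suppIn R (1 + 1) μ := by
    refine neg_mem (hf.absorbing.mul_mem_suppIn le_rfl (fun v hv => ?_) fun v hv => ?_)
    · have : u = v := by
        by_contra hne
        exact hv (by simp [hne])
      simpa [← this] using hu
    · exact hf.supp v fun h => hv (by rw [coeff_derivCoeffs, h, map_zero])
  have := factorial_smul_expansion_mem_Omega (b := b) (f := f) h
  simpa using this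

end Periods

/-! ### From extreme points of the Newton polytope to separating functionals. -/

section Vertex

variable {n : ℕ}

theorem toReal_injective : Function.Injective (toReal : (Fin n → ℤ) → Fin n → ℝ) := fun u v h =>
  funext fun i => by simpa [toReal] using congrFun h i

theorem finite_setOf_toReal_mem {S : Set (Fin n → ℝ)} (hS : Bornology.IsBounded S) :
    {u : Fin n → ℤ | toReal u ∈ S}.Finite := by
  obtain ⟨C, hC⟩ := hS.exists_norm_le
  refine (Set.finite_Icc (fun _ : Fin n => -⌈C⌉) (fun _ => ⌈C⌉)).subset fun u hu => ?_
  have key : ∀ i, |(u i : ℝ)| ≤ (⌈C⌉ : ℝ) := fun i =>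
    ((norm_le_pi_norm (toReal u) i).trans (hC _ hu)).trans (Int.le_ceil C)
  exact ⟨fun i => by exact_mod_cast (abs_le.1 (key i)).1, fun i => by exact_mod_cast (abs_le.1 (key i)).2⟩

variable {R : Type*} [CommRing R]

/-- An extreme point is not in the convex hull of the other exponents, which is compact, so
Hahn–Banach separates it strictly. -/
theorem exists_isVertex {f : Laurent R n} {b : Fin n → ℤ}
    (hb : toReal b ∈ (newtonPolytope f).extremePoints ℝ) (hfb : IsUnit (f.coeff b)) :
    ∃ ℓ, IsVertex ℓ b f := by
  set T : Set (Fin n → ℝ) := toReal '' ((f.coeff.support : Set (Fin n → ℤ)) \ {b}) with hT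
  have hTf : T.Finite := (f.coeff.support.finite_toSet.subset Set.sdiff_subset).image _
  have hsub : convexHull ℝ T ⊆ newtonPolytope f := convexHull_mono (Set.image_mono Set.sdiff_subset)
  have hbT : toReal b ∉ convexHull ℝ T := by
    intro h
    have h1 : toReal b ∈ (convexHull ℝ T).extremePoints ℝ :=
      inter_extremePoints_subset_extremePoints_of_subset hsub ⟨h, hb⟩
    obtain ⟨w, hw, hwb⟩ := extremePoints_convexHull_subset h1
    exact hw.2 (toReal_injective hwb)
  obtain ⟨φ, c, hφb, hφ⟩ := geometric_hahn_banach_point_closed (convex_convexHull ℝ T)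
    (hTf.isClosed_convexHull ℝ) hbT
  refine ⟨AddMonoidHom.mk' (fun u => φ (toReal u)) fun u v => by rw [toReal_add, map_add], hfb,
    fun w hw hwb => hφb.trans (hφ _ (subset_convexHull ℝ T ⟨w, ⟨hw, hwb⟩, rfl⟩))⟩

theorem exists_admissible {f : Laurent R n} {b : Fin n → ℤ} {μ : Set (Fin n → ℝ)}
    (hb : toReal b ∈ (newtonPolytope f).extremePoints ℝ) (hfb : IsUnit (f.coeff b))
    (hμ : IsOpenSubset (newtonPolytope f) μ) : ∃ ℓ, Admissible ℓ b (newtonPolytope f) μ f := by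
  obtain ⟨ℓ, hℓ⟩ := exists_isVertex hb hfb
  have hconv : Convex ℝ (newtonPolytope f) := convex_convexHull ℝ _
  refine ⟨ℓ, hℓ, fun u hu => ?_, hconv, hμ.absorbing hconv, fun k => finite_setOf_toReal_mem ?_⟩
  · rw [Nat.cast_one, one_smul]
    exact subset_convexHull ℝ _ ⟨u, by simpa using hu, rfl⟩
  · have hbd : Bornology.IsBounded (newtonPolytope f) :=
      isBounded_convexHull.2 ((f.coeff.support.finite_toSet.image _).isBounded)
    exact (hbd.subset hμ.1).smul₀ _

theorem mem_integralPoints {f : Laurent R n} {μ : Set (Fin n → ℝ)} (hμ : μ ⊆ newtonPolytope f)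
    (u : Fin n → ℤ) : u ∈ integralPoints f μ ↔ toReal u ∈ μ := by
  rw [integralPoints, Set.Finite.mem_toFinset]
  exact ⟨fun h => h.2, fun h => ⟨hμ h, h⟩⟩

end Vertex

/-! ### Existence and uniqueness of the matrices, and the congruences. -/

section Congruences

variable {R : Type*} [CommRing R] {n : ℕ} {p : ℕ} {ℓ : (Fin n → ℤ) →+ ℝ} {b : Fin n → ℤ}
  {Δ μ : Set (Fin n → ℝ)} {f : Laurent R n} {σ : R →+* R} {P : Finset (Fin n → ℤ)}

theorem exists_iterate_cartier_of_mem_formalDerivatives {ω : Formal R n}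
    (h : ω ∈ formalDerivatives p b μ σ f) (s : ℕ) :
    ∃ x, (cartier R n p)^[s] ω = (p : R) ^ s • x := by
  rcases Nat.eq_zero_or_pos s with rfl | hs
  · exact ⟨ω, by simp⟩
  · obtain ⟨η, -, hη⟩ := h.2 s hs
    exact ⟨η, hη⟩

theorem exists_iterate_cartier_sub {x y : Formal R n}
    (hx : ∀ s, ∃ z, (cartier R n p)^[s] x = (p : R) ^ s • z)
    (hy : ∀ s, ∃ z, (cartier R n p)^[s] y = (p : R) ^ s • z) (s : ℕ) :
    ∃ z, (cartier R n p)^[s] (x - y) = (p : R) ^ s • z := by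
  obtain ⟨v, hv⟩ := hx s
  obtain ⟨w, hw⟩ := hy s
  exact ⟨v - w, by rw [smul_sub, ← hv, ← hw, ← Module.End.pow_apply, ← Module.End.pow_apply,
    ← Module.End.pow_apply, map_sub]⟩

theorem constantTerm_sub (g : Laurent R n) (x y : Formal R n) :
    constantTerm g (x - y) = constantTerm g x - constantTerm g y := by
  simp [constantTerm_eq]

theorem constantTerm_sum_smul (g : Laurent R n) (a : P → R) (x : P → Formal R n) :
    constantTerm g (∑ v, a v • x v) = ∑ v, a v * constantTerm g (x v) := by
  simp [constantTerm_eq]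

theorem pow_dvd_constantTerm_derivationMatrix [Fact p.Prime] [IsDomain R] [CharZero R]
    (hσ : IsFrobeniusLift p σ) {u : P} {a : P → R}
    {δ : Derivation ℤ R R}
    (h : (fun e => δ (omega b f u e)) - ∑ v : P, a v • omega b f v ∈
      formalDerivatives p b μ σ f) (g : Laurent R n) (m : ℕ) :
    (p : R) ^ padicValNat p m ∣ δ (constantTerm (g ^ m) (omega b f u)) -
      ∑ v : P, a v * constantTerm (g ^ m) (omega b f v) := by
  have h1 := congrFun (deriv_act δ (g ^ m) (omega b f u)) 0
  have h2 := pow_dvd_constantTerm_pow hσ _ g (pow_padicValNat_dvd (p := p) (n := m))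
    (exists_iterate_cartier_of_mem_formalDerivatives h)
  rw [constantTerm_sub, constantTerm_sum_smul] at h2
  rw [constantTerm_eq, show δ (act (g ^ m) (omega b f u) 0) = _ from h1, Pi.add_apply,
    ← constantTerm_eq (g ^ m), add_sub_assoc]
  refine dvd_add ?_ h2
  rw [derivCoeffs_pow, map_smul, LinearMap.smul_apply, Pi.smul_apply, smul_eq_mul]
  refine Dvd.dvd.mul_right ?_ _
  exact_mod_cast Nat.cast_dvd_cast (α := R) (pow_padicValNat_dvd (p := p) (n := m))

variable [hp : Fact p.Prime] [IsDomain R] [CharZero R] [IsAdicComplete (Ideal.span {(p : R)}) R]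

theorem eq_of_sub_mem (hf : Admissible ℓ b Δ μ f) (hσ : IsFrobeniusLift p σ)
    (hP : ∀ u, u ∈ P ↔ toReal u ∈ μ) (hβ : IsUnit (hasseWittOn p P f)) {ω : Formal R n}
    {a a' : P → R}
    (h : ∀ s, ∃ z, (cartier R n p)^[s] (ω - ∑ u : P, a u • omega b f u) = (p : R) ^ s • z)
    (h' : ∀ s, ∃ z, (cartier R n p)^[s] (ω - ∑ u : P, a' u • omega b f u) = (p : R) ^ s • z) :
    a = a' := by
  refine sub_eq_zero.1 (eq_zero_of_iterate_cartier_sum_omega hf hσ hP hβ fun s => ?_)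
  have h1 := exists_iterate_cartier_sub h' h s
  rw [sub_sub_sub_cancel_left] at h1
  simpa only [Pi.sub_apply, sub_smul, Finset.sum_sub_distrib] using h1

theorem existsUnique_matrix (hp2 : p ≠ 2) (hf : Admissible ℓ b Δ μ f) (hσ : IsFrobeniusLift p σ)
    (hP : ∀ u, u ∈ P ↔ toReal u ∈ μ) (hβ : IsUnit (hasseWittOn p P f)) {ω : P → Formal R n}
    (hω : ∀ u, ω u ∈ completedOmega p b μ f) :
    ∃! A : Matrix P P R, ∀ u, ω u - ∑ v : P, A u v • omega b f v ∈
      formalDerivatives p b μ σ f := by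
  choose A hA using fun u => exists_sub_mem_formalDerivatives hp2 hf hσ hP hβ (hω u)
  refine ⟨A, hA, fun A' hA' => funext fun u => eq_of_sub_mem hf hσ hP hβ
    (exists_iterate_cartier_of_mem_formalDerivatives (hA' u))
    (exists_iterate_cartier_of_mem_formalDerivatives (hA u))⟩

theorem cartier_omega_mem_completedOmega (hp2 : p ≠ 2) (hf : Admissible ℓ b Δ μ f)
    (hσ : IsFrobeniusLift p σ) (hP : ∀ u, u ∈ P ↔ toReal u ∈ μ) (u : P) :
    cartier R n p (omega b f u) ∈ completedOmega p b μ (twist σ f) := by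
  obtain ⟨η, hη, h⟩ := (isExpansionSum_omega hf.isVertex
    ((hP u).1 u.2)).exists_cartier_eq_completedOmega hp2 hf hσ
  rw [expansion_cartier_numerator_omega hf hP u] at h
  rw [h]
  exact add_mem (sum_mem fun v _ => Submodule.smul_mem _ _
    (Omega_le_completedOmega (omega_mem_Omega ((hP v).1 v.2)))) (Submodule.smul_mem _ _ hη)

/-- The remainder in the definition of the Cartier matrix is `p` times an element on which all
iterates of the Cartier operator are divisible by the corresponding power of `p`. -/
theorem exists_eq_smul_of_cartier_omega_sub_mem (hf : Admissible ℓ b Δ μ f)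
    (hσ : IsFrobeniusLift p σ) (hP : ∀ u, u ∈ P ↔ toReal u ∈ μ)
    (hβ : IsUnit (hasseWittOn p P f)) {u : P} {a : P → R}
    (h : ∀ s, ∃ z, (cartier R n p)^[s] (cartier R n p (omega b f u) -
      ∑ v : P, a v • omega b (twist σ f) v) = (p : R) ^ s • z) :
    ∃ ξ, cartier R n p (omega b f u) - ∑ v : P, a v • omega b (twist σ f) v = (p : R) • ξ ∧
      ∀ s, ∃ z, (cartier R n p)^[s] ξ = (p : R) ^ s • z := by
  have hF := hf.map_twist σ
  have hβF : IsUnit (hasseWittOn p P (twist σ f)) := isUnit_hasseWittOn_iterate_twist hβ σ 1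
  obtain ⟨η, ⟨y, hy⟩, hη⟩ := (isExpansionSum_omega hf.isVertex
    ((hP u).1 u.2)).exists_cartier_eq_expansionSums hf hσ
  rw [expansion_cartier_numerator_omega hf hP u] at hη
  obtain ⟨c, hc⟩ := hy.exists_decomposition hF hσ hP hβF
  set ξ := η - ∑ v : P, c v • omega b (twist σ f) v with hξ
  have heq : cartier R n p (omega b f u) -
      ∑ v : P, (hasseWittOn p P f u + (p : R) • c) v • omega b (twist σ f) v = (p : R) • ξ := by
    simp_rw [hη, hξ, Pi.add_apply, Pi.smul_apply, add_smul, Finset.sum_add_distrib, smul_assoc,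
      ← Finset.smul_sum, smul_sub]
    abel
  -- Decomposing η gives one admissible coefficient row with remainder pξ; uniqueness forces the
  -- given row to be this one.
  have ha : a = hasseWittOn p P f u + (p : R) • c := by
    refine eq_of_sub_mem hF hσ hP hβF h fun s => ?_
    obtain ⟨z, hz⟩ := hc s
    exact ⟨(p : R) • z, by rw [heq, ← Module.End.pow_apply, map_smul, Module.End.pow_apply, hz, smul_comm]⟩
  exact ⟨ξ, by rw [ha, heq], hc⟩

theorem pow_dvd_constantTerm_cartierMatrix (hf : Admissible ℓ b Δ μ f)
    (hσ : IsFrobeniusLift p σ) (hP : ∀ u, u ∈ P ↔ toReal u ∈ μ)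
    (hβ : IsUnit (hasseWittOn p P f)) {u : P} {a : P → R}
    (h : cartier R n p (omega b f u) - ∑ v : P, a v • omega b (twist σ f) v ∈
      formalDerivatives p b μ σ (twist σ f)) (g : Laurent R n) (m : ℕ) :
    (p : R) ^ padicValNat p m ∣ constantTerm (g ^ m) (omega b f u) -
      ∑ v : P, a v * σ (constantTerm (g ^ (m / p)) (omega b f v)) := by
  rcases hs : padicValNat p m with _ | s
  · simp
  obtain ⟨q, rfl⟩ : p ∣ m := dvd_of_one_le_padicValNat (by omega)
  have hq : p ^ s ∣ q := Nat.dvd_of_mul_dvd_mul_left hp.out.pos (by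
    rw [← pow_succ', ← hs]
    exact pow_padicValNat_dvd)
  obtain ⟨ξ, hξ, hξs⟩ := exists_eq_smul_of_cartier_omega_sub_mem hf hσ hP hβ
    (exists_iterate_cartier_of_mem_formalDerivatives h)
  have hmap : ∀ v : P, σ (constantTerm (g ^ q) (omega b f v)) =
      constantTerm (twist σ g ^ q) (omega b (twist σ f) v) := by
    intro v
    rw [constantTerm_eq, constantTerm_eq, map_act, map_omega hf.isVertex, twist_pow]
  simp_rw [Nat.mul_div_cancel_left q hp.out.pos, hmap]
  rw [← constantTerm_sum_smul, ← sub_add_sub_cancel _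
    (constantTerm (twist σ g ^ q) (cartier R n p (omega b f u))), ← constantTerm_sub _ (cartier R n p _), hξ]
  refine dvd_add (pow_dvd_constantTerm_sub hσ g hq _) ?_
  rw [constantTerm_eq, map_smul, Pi.smul_apply, smul_eq_mul, pow_succ', ← constantTerm_eq]
  exact mul_dvd_mul_left _ (pow_dvd_constantTerm_pow hσ s _ hq hξs)

end Congruences

end

end DworkCrystals

theorem mainTheorem5 {R : Type*} [CommRing R] [IsDomain R] [CharZero R]
    (p : ℕ) [Fact p.Prime] [IsAdicComplete (Ideal.span {(p : R)}) R]
    {n : ℕ} (f : DworkCrystals.Laurent R n)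
    (b : Fin n → ℤ)
    (hb : DworkCrystals.toReal b ∈ (DworkCrystals.newtonPolytope f).extremePoints ℝ)
    (hfb : IsUnit (f.coeff b))
    (μ : Set (Fin n → ℝ))
    (hμ : DworkCrystals.IsOpenSubset (DworkCrystals.newtonPolytope f) μ)
    (hβ : IsUnit (DworkCrystals.hasseWitt p μ f))
    (g : DworkCrystals.Laurent R n)
    (σ : R →+* R) (hσ : DworkCrystals.IsFrobeniusLift p σ)
    (δ : Derivation ℤ R R) :
    (p ≠ 2 →
      (∃! Λ, DworkCrystals.IsCartierMatrix p b μ σ f Λ) ∧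
      (∃! N, DworkCrystals.IsDerivationMatrix p b μ σ δ f N)) ∧
    (∀ Λ, DworkCrystals.IsCartierMatrix p b μ σ f Λ →
      ∀ m : ℕ, 1 ≤ m → ∀ u, (p : R) ^ padicValNat p m ∣
        DworkCrystals.periodVector b μ f g m u -
          Λ.mulVec (fun v => σ (DworkCrystals.periodVector b μ f g (m / p) v)) u) ∧
    (∀ N, DworkCrystals.IsDerivationMatrix p b μ σ δ f N →
      ∀ m : ℕ, 1 ≤ m → ∀ u, (p : R) ^ padicValNat p m ∣
        δ (DworkCrystals.periodVector b μ f g m u) -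
          N.mulVec (DworkCrystals.periodVector b μ f g m) u) := by
  obtain ⟨ℓ, hf⟩ := DworkCrystals.exists_admissible hb hfb hμ
  have hP := DworkCrystals.mem_integralPoints hμ.1
  -- C_p(ω_u) is decomposed over f^σ, so the Hasse–Witt matrix must be invertible there too.
  have hβF := DworkCrystals.isUnit_hasseWittOn_iterate_twist hβ σ 1
  refine ⟨fun hp2 => ⟨?_, ?_⟩, fun Λ hΛ m _ u => ?_, fun N hN m _ u => ?_⟩
  · exact DworkCrystals.existsUnique_matrix hp2 (hf.map_twist σ) hσ hP hβF
      (DworkCrystals.cartier_omega_mem_completedOmega hp2 hf hσ hP)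
  · exact DworkCrystals.existsUnique_matrix hp2 hf hσ hP hβ fun u =>
      DworkCrystals.Omega_le_completedOmega
        (DworkCrystals.deriv_omega_mem_Omega hf δ ((hP u).1 u.2))
  · exact DworkCrystals.pow_dvd_constantTerm_cartierMatrix hf hσ hP hβ (hΛ u) g m
  · exact DworkCrystals.pow_dvd_constantTerm_derivationMatrix hσ (hN u) g m
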